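/- **Setting.** Let $Z,A,M,Y$ be random variables with arbitrary state spaces and a joint density $p=p(Z,A,M,Y)$ with respect to a product of $\sigma$-finite measures, $p>0$ almost everywhere (sums below stand for integrals, and equalities hold almost everywhere). An ADMG has directed edges ($\to$, without directed cycles) and bidirected edges ($\leftrightarrow$); in a CADMG some vertices are fixed and have no incoming arrowheads. For an ADMG $\mathcal G$ on $V$ and $S\subseteq V$ let $\mathcal G(V\setminus S,S)$ be the CADMG obtained by deleting all arrowheads into $S$. Districts are the bidirected-connected components of the random vertices. A random vertex $v$ is fixable if no other random vertex is reached from $v$ both by a directed and by a bidirected path; fixing $v$ deletes the arrowheads into $v$ and divides the kernel $q(R\mid W)$ by $q(v\mid \mathrm{mb}(v),W)$, where the Markov blanket $\mathrm{mb}(v)$ consists of the district of $v$ and its parents, without $v$. A set $D$ is intrinsic in $\mathcal G$ if $V\setminus D$ can be fixed successively, leaving the single district $D$. The density $p$ nested Markov factorizes with respect to $\mathcal G$ if there are kernels $q_D(D\mid \mathrm{pa}_{\mathcal G}(D))$, one for each intrinsic $D$, such that for every valid fixing sequence the resulting kernel is the product of the $q_D$ over the districts $D$ of the resulting CADMG.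 The post-intervention distribution $p(V\setminus S\mid \mathrm{do}(S))$ is identified in $\mathcal G$ if every district of $\mathcal G(V\setminus S,S)$ is intrinsic in $\mathcal G$. **Assumptions.** Let $p$ nested Markov factorize with respect to an ADMG $\mathcal G$ on $\{Z,A,M,Y\}$ such that: - (A1) $M$ is a mediator between $A$ and $Y$, i.e. it lies on a directed path from $A$ to $Y$ in $\mathcal G$. - (A2) $Z$ is not a descendant of $A$ in $\mathcal G$, and $Z\not\perp A$ and $Z\not\perp Y\mid A,M$ in $p$. - (A3) (Verma faithfulness) Every ordinary conditional independence between two variables in $p$ implies the corresponding m-separation in $\mathcal G$. Moreover, let $a,b$ be two variables that are not independent in $p$ given any set of the other variables, let $S$ and $C$ be disjoint sets of variables not containing $a,b$, and let $\prec$ be a topological order of $\mathcal G$; if $a\perp b\mid C$ in the g-formula kernel $p(V)/\prod_{s\in S}p(s\mid\{u: u\prec s\})$, with the variables in $S$ fixed, then $p(V\setminus S\mid\mathrm{do}(S))$ is identified in $\mathcal G$, and $a$ and $b$ are m-separated given $C$ (and the fixed $S$) in $\mathcal G(V\setminus S,S)$. **Pattern.** Let $\mathcal P$ be the set of ADMGs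 on $\{Z,A,M,Y\}$ that contain $A\to M$, $M\to Y$, $A\leftrightarrow Y$, have no other edges except possibly $Z\to A$, $Z\leftrightarrow A$, $Z\to M$, $Z\leftrightarrow M$, contain at least one of $Z\to A$ and $Z\leftrightarrow A$, and have no bidirected path from $A$ to $M$. **Theorem.** 1. If (A1)–(A3) hold and $Z\perp Y$ in $p(Z,A,M,Y)/p(M\mid A,Z)$ (a kernel for $Z,A,Y$ with $M$ fixed), then $p$ nested Markov factorizes with respect to an ADMG, namely $\mathcal G$, in which $A$ has no bidirected path to any of its children. In particular, (F1) $A\to Y$ is absent from $\mathcal G$, (F2) $A\leftrightarrow M$ and $M\leftrightarrow Y$ are absent from $\mathcal G$, and $\mathcal G\in\mathcal P$. 2. $\mathcal P$ is exactly the set of admissible ADMGs on $\{Z,A,M,Y\}$, i.e. those in which $M$ lies on a directed path from $A$ to $Y$, $Z$ is not a descendant of $A$, $Z$ is m-connected to $A$ given $\emptyset$ and to $Y$ given $\{A,M\}$, $p(Z,A,Y\mid\mathrm{do}(M))$ is identified, and $Z$ and $Y$ are m-separated in the CADMG in which $M$ is fixed. Moreover, for every $\mathcal H\in\mathcal P$,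 every almost everywhere positive density that nested Markov factorizes with respect to $\mathcal H$ satisfies $Z\perp Y$ in $p(Z,A,M,Y)/p(M\mid A,Z)$. -/

import Mathlib

open MeasureTheory
open scoped ENNReal

/-! ### Conditional acyclic directed mixed graphs -/

/-- A conditional ADMG on the vertex type `V`: the vertices in `rand` are random, the others are
fixed. `dir u v` is the edge `u → v`, `bi u v` is the edge `u ↔ v`. No arrowhead points at a fixed
vertex. -/
structure CADMG (V : Type*) where
  rand : Finset V
  dir : V → V → Prop
  bi : V → V → Prop
  bi_symm : ∀ u v, bi u v → bi v u
  bi_irrefl : ∀ v, ¬ bi v v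
  acyclic : ∀ v, ¬ Relation.TransGen dir v v
  dir_rand : ∀ u v, dir u v → v ∈ rand
  bi_rand : ∀ u v, bi u v → u ∈ rand

/-- The kinds of edges met when a path is traversed: `→`, `←`, `↔`. -/
inductive EdgeKind where
  | fwd
  | bwd
  | bidir

/-- The edge has an arrowhead at the vertex where its traversal ends. -/
def EdgeKind.headAtEnd : EdgeKind → Prop
  | .fwd => True
  | .bwd => False
  | .bidir => True

/-- The edge has an arrowhead at the vertex where its traversal starts. -/
def EdgeKind.headAtStart : EdgeKind → Prop
  | .fwd => False
  | .bwd => True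
  | .bidir => True

namespace CADMG

variable {V : Type*}

/-- `G` has the edge from `u` to `v` of the given kind. -/
def HasEdge (G : CADMG V) (u : V) : EdgeKind → V → Prop
  | .fwd, v => G.dir u v
  | .bwd, v => G.dir v u
  | .bidir, v => G.bi u v

/-- The walk that starts at a vertex and follows the listed edges is open given `C`: every inner
collider is an ancestor of a vertex of `C` (or in `C`), every inner non-collider is outside `C`. -/
def OpenWalk (G : CADMG V) (C : Finset V) : V → List (EdgeKind × V) → Prop
  | _, [] => True
  | x, [(k, y)] => G.HasEdge x k y
  | x, (k₁, v) :: (k₂, w) :: l =>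
      G.HasEdge x k₁ v ∧
      ((k₁.headAtEnd ∧ k₂.headAtStart) → ∃ c ∈ C, Relation.ReflTransGen G.dir v c) ∧
      (¬ (k₁.headAtEnd ∧ k₂.headAtStart) → v ∉ C) ∧
      OpenWalk G C v ((k₂, w) :: l)

/-- m-separation of two vertices given `C`: no path (without repeated vertices) between them is
open given `C`. -/
def MSep (G : CADMG V) (x y : V) (C : Finset V) : Prop :=
  ¬ ∃ l : List (EdgeKind × V),
      l.map Prod.snd ≠ [] ∧ (l.map Prod.snd).getLast? = some y ∧
      (x :: l.map Prod.snd).Nodup ∧ G.OpenWalk C x l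

/-- A random vertex is fixable if no other random vertex is reached from it both by a directed path
and by a bidirected path. -/
def Fixable (G : CADMG V) (v : V) : Prop :=
  v ∈ G.rand ∧ ∀ u ∈ G.rand, u ≠ v →
    ¬ (Relation.TransGen G.dir v u ∧ Relation.TransGen G.bi v u)

variable [DecidableEq V]

/-- The CADMG in which the vertices of `S` are fixed: all arrowheads into `S` are removed. -/
def fixSet (G : CADMG V) (S : Finset V) : CADMG V where
  rand := G.rand \ S
  dir u v := G.dir u v ∧ v ∉ S
  bi u v := G.bi u v ∧ u ∉ S ∧ v ∉ S
  bi_symm u v h := ⟨G.bi_symm u v h.1, h.2.2, h.2.1⟩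
  bi_irrefl v h := G.bi_irrefl v h.1
  acyclic v h := G.acyclic v (Relation.TransGen.mono (fun _ _ h => h.1) _ _ h)
  dir_rand u v h := Finset.mem_sdiff.2 ⟨G.dir_rand u v h.1, h.2⟩
  bi_rand u v h := Finset.mem_sdiff.2 ⟨G.bi_rand u v h.1, h.2.1⟩

/-- The list is a valid fixing sequence. -/
def ValidFixing : CADMG V → List V → Prop
  | _, [] => True
  | G, v :: l => G.Fixable v ∧ ValidFixing (G.fixSet {v}) l

/-- Fixing the vertices of a list, one after the other. -/
def fixSeq : CADMG V → List V → CADMG V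
  | G, [] => G
  | G, v :: l => fixSeq (G.fixSet {v}) l

variable [Fintype V]

/-- An ADMG is a CADMG without fixed vertices. -/
def IsADMG (G : CADMG V) : Prop := G.rand = Finset.univ

open Classical in
/-- The district of a vertex: the random vertices that are joined to it by a bidirected path. -/
noncomputable def district (G : CADMG V) (v : V) : Finset V :=
  G.rand.filter fun u => Relation.ReflTransGen G.bi v u

/-- The set of districts. -/
noncomputable def districts (G : CADMG V) : Finset (Finset V) :=
  G.rand.image G.district

open Classical in
/-- The parents of the vertices of a set. -/
noncomputable def parents (G : CADMG V) (D : Finset V) : Finset V :=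
  Finset.univ.filter fun u => ∃ v ∈ D, G.dir u v

/-- The Markov blanket: the district and the parents of the district, without the vertex itself. -/
noncomputable def mb (G : CADMG V) (v : V) : Finset V :=
  (G.district v ∪ G.parents (G.district v)).erase v

/-- `D` is intrinsic in the ADMG `G`: its complement can be fixed, and fixing it leaves the single
district `D`. -/
def Intrinsic (G : CADMG V) (D : Finset V) : Prop :=
  ∃ l : List V, G.ValidFixing l ∧ l.toFinset = Finset.univ \ D ∧
    (G.fixSeq l).districts = {D}

/-- The post-intervention distribution `p(V \ S | do(S))` is identified in the ADMG `G`: every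
district of the CADMG in which `S` is fixed is intrinsic in `G`. -/
def Identified (G : CADMG V) (S : Finset V) : Prop :=
  ∀ D ∈ (G.fixSet S).districts, G.Intrinsic D

/-- The order of the vertices given by the injective ranking `r` is a topological order of `G`. -/
def IsTopological (G : CADMG V) (r : V → ℕ) : Prop :=
  Function.Injective r ∧ ∀ u v, G.dir u v → r u < r v

end CADMG

/-! ### Kernels and the nested Markov factorization

All densities and kernels are functions on the full product of the state spaces, with respect to a
product of σ-finite reference measures; `∫⋯∫⁻_T` integrates out the coordinates in `T` (a sum over
them if the reference measures are counting measures). -/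

section Kernels

variable {V : Type*} [Fintype V] [DecidableEq V] {X : V → Type*} [∀ v, MeasurableSpace (X v)]
  (μ : ∀ v, Measure (X v))

/-- A joint probability density that is positive almost everywhere. -/
structure IsPosDensity (p : (∀ v, X v) → ℝ≥0∞) : Prop where
  measurable : Measurable p
  lintegral_eq_one : ∫⁻ x, p x ∂(Measure.pi μ) = 1
  pos : ∀ᵐ x ∂(Measure.pi μ), 0 < p x

/-- The margin `q(T | W)` of a kernel `q(R | W)` with random variables `R`. -/
noncomputable def kernelMargin (R : Finset V) (q : (∀ v, X v) → ℝ≥0∞) (T : Finset V) :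
    (∀ v, X v) → ℝ≥0∞ :=
  lmarginal μ (R \ T) q

/-- The conditional kernel `q(v | C, W)` of a kernel `q(R | W)` with random variables `R`. -/
noncomputable def kernelCond (R : Finset V) (q : (∀ v, X v) → ℝ≥0∞) (v : V) (C : Finset V) :
    (∀ v, X v) → ℝ≥0∞ :=
  fun x => kernelMargin μ R q (insert v C) x / kernelMargin μ R q C x

/-- Independence of the random variables `a` and `b` given `C` in a kernel `q(R | W)`:
`q(a, b, C | W) q(C | W) = q(a, C | W) q(b, C | W)`. -/
def KernelIndep (R : Finset V) (q : (∀ v, X v) → ℝ≥0∞) (a b : V) (C : Finset V) : Prop :=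
  ∀ᵐ x ∂(Measure.pi μ),
    kernelMargin μ R q (insert a (insert b C)) x * kernelMargin μ R q C x =
      kernelMargin μ R q (insert a C) x * kernelMargin μ R q (insert b C) x

/-- Ordinary conditional independence of `a` and `b` given `C` under the density `p`. -/
def DensityIndep (p : (∀ v, X v) → ℝ≥0∞) (a b : V) (C : Finset V) : Prop :=
  KernelIndep μ Finset.univ p a b C

/-- The kernel obtained from `q` by fixing the vertices of a list in `G`, one after the other: to
fix `v`, divide by the conditional kernel of `v` given its Markov blanket and the fixed variables. -/
noncomputable def fixKernel : CADMG V → List V → ((∀ v, X v) → ℝ≥0∞) → ((∀ v, X v) → ℝ≥0∞)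
  | _, [], q => q
  | G, v :: l, q =>
      fixKernel (G.fixSet {v}) l fun x => q x / kernelCond μ G.rand q v (G.mb v) x

/-- `q` is a kernel `q(D | P)`: it depends on the variables in `D ∪ P` only and is a normalized
density over `D` for all values of the other variables. -/
structure IsKernel (D P : Finset V) (q : (∀ v, X v) → ℝ≥0∞) : Prop where
  measurable : Measurable q
  dependsOn : DependsOn q (↑(D ∪ P) : Set V)
  normalized : ∀ x, lmarginal μ D q x = 1

/-- The nested Markov factorization of the density `p` with respect to the ADMG `G`. -/
def NestedMarkov (p : (∀ v, X v) → ℝ≥0∞) (G : CADMG V) : Prop :=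
  ∃ q : Finset V → ((∀ v, X v) → ℝ≥0∞),
    (∀ D, G.Intrinsic D → IsKernel μ D (G.parents D) (q D)) ∧
    ∀ l : List V, G.ValidFixing l →
      fixKernel μ G l p =ᵐ[Measure.pi μ] fun x => ∏ D ∈ (G.fixSeq l).districts, q D x

/-- The g-formula for an intervention on `S`, with respect to the order of the variables given by
`r`: from the chain-rule factorization of `p` the factors of the variables in `S` are dropped. -/
noncomputable def gFormula (p : (∀ v, X v) → ℝ≥0∞) (r : V → ℕ) (S : Finset V) :
    (∀ v, X v) → ℝ≥0∞ :=
  fun x => p x /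
    ∏ s ∈ S, kernelCond μ Finset.univ p s (Finset.univ.filter fun u => r u < r s) x

/-- Verma faithfulness of `p` to `G`. Every ordinary independence is due to m-separation. If two
variables admit no ordinary independence, but are independent in a post-intervention distribution
obtained from `p` by the g-formula (along a topological order of `G`), then this post-intervention
distribution is identified in `G` and the independence is due to m-separation in its CADMG. The
fixed variables of a CADMG are held constant, so they belong to the conditioning set. -/
structure VermaFaithful (p : (∀ v, X v) → ℝ≥0∞) (G : CADMG V) : Prop where
  ordinary : ∀ (a b : V) (C : Finset V), a ≠ b → a ∉ C → b ∉ C →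
    DensityIndep μ p a b C → G.MSep a b C
  generalized : ∀ (r : V → ℕ) (S C : Finset V) (a b : V), G.IsTopological r → Disjoint S C →
    a ≠ b → a ∉ S ∪ C → b ∉ S ∪ C →
    (∀ C' : Finset V, a ∉ C' → b ∉ C' → ¬ DensityIndep μ p a b C') →
    KernelIndep μ (Finset.univ \ S) (gFormula μ p r S) a b C →
    G.Identified S ∧ (G.fixSet S).MSep a b (S ∪ C)

end Kernels

/-! ### Anchor, treatment, mediator and outcome -/

/-- The anchor, the treatment, the mediator and the outcome. -/
inductive Var where
  | Z
  | A
  | M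
  | Y
  deriving DecidableEq

instance : Fintype Var where
  elems := {Var.Z, Var.A, Var.M, Var.Y}
  complete v := by cases v <;> decide

namespace FrontDoor

open Var

/-- `M` is a mediator between `A` and `Y`: it lies on a directed path from `A` to `Y`. -/
def Mediates (G : CADMG Var) : Prop :=
  Relation.TransGen G.dir A M ∧ Relation.TransGen G.dir M Y

/-- `Z` is not a causal consequence of `A`. -/
def NotConsequence (G : CADMG Var) : Prop :=
  ¬ Relation.TransGen G.dir A Z

/-- `A` has no bidirected path to any of its children. -/
def NoBidirectedPathToChild (G : CADMG Var) : Prop :=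
  ∀ c, G.dir A c → ¬ Relation.TransGen G.bi A c

/-- The ADMGs of the pattern: the edges `A → M`, `M → Y`, `A ↔ Y` are present; the edges `Z → A`,
`Z ↔ A`, `Z → M`, `Z ↔ M` are optional; there are no other edges; one of `Z → A`, `Z ↔ A` is
present; and `A` has no bidirected path to `M`. -/
structure InPattern (G : CADMG Var) : Prop where
  isADMG : G.IsADMG
  dir_A_M : G.dir A M
  dir_M_Y : G.dir M Y
  bi_A_Y : G.bi A Y
  dir_only : ∀ u v, G.dir u v →
    (u = Z ∧ v = A) ∨ (u = Z ∧ v = M) ∨ (u = A ∧ v = M) ∨ (u = M ∧ v = Y)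
  bi_only : ∀ u v, G.bi u v →
    s(u, v) = s(Z, A) ∨ s(u, v) = s(Z, M) ∨ s(u, v) = s(A, Y)
  anchor : G.dir Z A ∨ G.bi Z A
  no_path : ¬ Relation.TransGen G.bi A M

/-- The ADMG `G` is admissible: `M` mediates between `A` and `Y`; `Z` is not a causal consequence of
`A`, and is m-connected to `A`, and to `Y` given `A` and `M`; `p(Z, A, Y | do(M))` is identified and
`Z`, `Y` are m-separated in its CADMG. -/
structure Admissible (G : CADMG Var) : Prop where
  isADMG : G.IsADMG
  mediates : Mediates G
  notConsequence : NotConsequence G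
  relevant_A : ¬ G.MSep Z A ∅
  relevant_Y : ¬ G.MSep Z Y {A, M}
  identified : G.Identified {M}
  mSep : (G.fixSet {M}).MSep Z Y {M}

variable {X : Var → Type*} [∀ v, MeasurableSpace (X v)] (μ : ∀ v, Measure (X v))

/-- The Verma constraint: `Z` and `Y` are independent in the kernel
`p(Z, A, M, Y) / p(M | A, Z)` with random variables `Z`, `A`, `Y`. -/
def VermaConstraint (p : (∀ v, X v) → ℝ≥0∞) : Prop :=
  KernelIndep μ {Z, A, Y} (fun x => p x / kernelCond μ Finset.univ p M {A, Z} x) Z Y ∅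

end FrontDoor

/-! ### Marginals of functions on a product space -/

theorem dependsOn_finsetProd {ι : Type*} {V : Type*} {X : V → Type*} (s : Finset ι)
    {f : ι → (∀ v, X v) → ℝ≥0∞} {T : Set V}
    (hf : ∀ i ∈ s, DependsOn (f i) T) : DependsOn (fun x => ∏ i ∈ s, f i x) T :=
  fun _ _ hxy => Finset.prod_congr rfl fun i hi => hf i hi hxy

section Marginals

variable {V : Type*} [DecidableEq V] {X : V → Type*} [∀ v, MeasurableSpace (X v)]
  {μ : ∀ v, Measure (X v)}

theorem DependsOn.lmarginal {g : (∀ v, X v) → ℝ≥0∞} {T : Set V} (hg : DependsOn g T)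
    (S : Finset V) : DependsOn (lmarginal μ S g) T := by
  intro x y hxy
  refine lintegral_congr fun z => hg fun i hi => ?_
  simp only [Function.updateFinset]
  split_ifs
  · rfl
  · exact hxy i hi

theorem dependsOn_lmarginal_compl (S : Finset V) (f : (∀ v, X v) → ℝ≥0∞) :
    DependsOn (lmarginal μ S f) (↑S : Set V)ᶜ := fun _ _ hxy =>
  lmarginal_congr μ f fun i hi => hxy i (by simpa using hi)

theorem lmarginal_const_mul {g f : (∀ v, X v) → ℝ≥0∞} {S : Finset V}
    (hg : DependsOn g (↑S : Set V)ᶜ) (hf : Measurable f) :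
    lmarginal μ S (fun x => g x * f x) = fun x => g x * lmarginal μ S f x := by
  ext x
  have h : ∀ y, g (Function.updateFinset x S y) = g x := fun y => hg fun i hi => by
    simp only [Function.updateFinset]
    rw [dif_neg (by simpa using hi)]
  simp only [lmarginal, h]
  exact lintegral_const_mul _ (hf.comp measurable_updateFinset)

variable [∀ v, SigmaFinite (μ v)]

theorem lmarginal_lmarginal_sdiff {f : (∀ v, X v) → ℝ≥0∞} (hf : Measurable f) {S T : Finset V}
    (hST : S ⊆ T) : lmarginal μ (T \ S) (lmarginal μ S f) = lmarginal μ T f := by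
  rw [← lmarginal_union μ f hf Finset.sdiff_disjoint, Finset.sdiff_union_of_subset hST]

variable [Fintype V]

/-- By Tonelli the integral of the marginal is the integral of `f` times the mass of the
`S`-coordinates. This is what transports null sets through marginals. -/
theorem lmarginal_ae_eq_zero_iff {f : (∀ v, X v) → ℝ≥0∞} (hf : Measurable f) (S : Finset V) :
    lmarginal μ S f =ᵐ[Measure.pi μ] 0 ↔ f =ᵐ[Measure.pi μ] 0 := by
  rcases isEmpty_or_nonempty (∀ v, X v) with hX | ⟨⟨x₀⟩⟩
  · simp [Measure.eq_zero_of_isEmpty (Measure.pi μ), Filter.EventuallyEq]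
  rw [← lintegral_eq_zero_iff hf, ← lintegral_eq_zero_iff (hf.lmarginal μ)]
  have hmarg : ∀ g : (∀ v, X v) → ℝ≥0∞, Measurable g →
      lmarginal μ Sᶜ (lmarginal μ S g) = fun _ => ∫⁻ x, g x ∂Measure.pi μ := fun g hg => by
    rw [Finset.compl_eq_univ_sdiff, lmarginal_lmarginal_sdiff hg (Finset.subset_univ S),
      lmarginal_univ]
  have key : ∫⁻ x, lmarginal μ S f x ∂Measure.pi μ =
      (∫⁻ x, f x ∂Measure.pi μ) * lmarginal μ S 1 x₀ := by
    rw [lintegral_eq_lmarginal_univ x₀, ← Finset.union_compl S,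
      lmarginal_union μ _ (hf.lmarginal μ) disjoint_compl_right, hmarg f hf]
    have := congrFun (lmarginal_const_mul (μ := μ) (S := S)
      (g := fun _ => ∫⁻ x, f x ∂Measure.pi μ) (f := 1) (fun _ _ _ => rfl) measurable_one) x₀
    simpa using this
  rw [key, mul_eq_zero]
  refine ⟨fun h => h.elim id fun h1 => ?_, Or.inl⟩
  -- The mass of the `S`-coordinates is the same at every base point; if it is zero, the product
  -- measure itself vanishes.
  have hconst : lmarginal μ S (1 : (∀ v, X v) → ℝ≥0∞) = fun _ => 0 := by
    ext x
    rw [← h1]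
    simp [lmarginal]
  have h0 := congrFun (hmarg 1 measurable_one) x₀
  rw [hconst] at h0
  have : Measure.pi μ = 0 := by
    rw [← Measure.measure_univ_eq_zero]
    simpa [lmarginal] using h0.symm
  simp [this]

/-- Neither function need be measurable: cover the exceptional set by a measurable null set, almost
all of whose `S`-fibres are null. -/
theorem Filter.EventuallyEq.lmarginal {f g : (∀ v, X v) → ℝ≥0∞} (h : f =ᵐ[Measure.pi μ] g)
    (S : Finset V) : lmarginal μ S f =ᵐ[Measure.pi μ] lmarginal μ S g := by
  set N := toMeasurable (Measure.pi μ) {x | f x ≠ g x}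
  have hN : MeasurableSet N := measurableSet_toMeasurable _ _
  have hm : Measurable (N.indicator (1 : (∀ v, X v) → ℝ≥0∞)) := measurable_one.indicator hN
  have h0 : N.indicator (1 : (∀ v, X v) → ℝ≥0∞) =ᵐ[Measure.pi μ] 0 := by
    have hN0 : Measure.pi μ N = 0 := by
      rw [measure_toMeasurable]
      exact h
    filter_upwards [measure_eq_zero_iff_ae_notMem.1 hN0] with x hx
    simp [hx]
  filter_upwards [(lmarginal_ae_eq_zero_iff hm S).2 h0] with x hx
  refine lintegral_congr_ae ?_
  have hx' := (lintegral_eq_zero_iff (hm.comp measurable_updateFinset)).1 hx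
  filter_upwards [hx'] with y hy
  by_contra hne
  have : Function.updateFinset x S y ∈ N := subset_toMeasurable _ _ hne
  simp [this] at hy

/-- The zero set `B` of the marginal ignores the coordinates in `S`, so its indicator can be pulled
inside. Then `f` vanishes almost everywhere on `B`, and positivity makes `B` null. -/
theorem lmarginal_ne_zero_ae {f : (∀ v, X v) → ℝ≥0∞} (hf : Measurable f)
    (hpos : ∀ᵐ x ∂Measure.pi μ, f x ≠ 0) (S : Finset V) :
    ∀ᵐ x ∂Measure.pi μ, lmarginal μ S f x ≠ 0 := by
  set B : Set (∀ v, X v) := {x | lmarginal μ S f x = 0}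
  have hB : MeasurableSet B := hf.lmarginal μ (measurableSet_singleton 0)
  have hdep : DependsOn (B.indicator (1 : (∀ v, X v) → ℝ≥0∞)) (↑S : Set V)ᶜ := fun x y hxy => by
    have : x ∈ B ↔ y ∈ B := by
      simp only [B, Set.mem_ofPred_eq, dependsOn_lmarginal_compl S f hxy]
    by_cases hx : x ∈ B
    · simp [hx, this.1 hx]
    · simp [hx, mt this.2 hx]
  have hm : Measurable fun x => B.indicator (1 : (∀ v, X v) → ℝ≥0∞) x * f x :=
    (measurable_one.indicator hB).mul hf
  have h0 := (lmarginal_ae_eq_zero_iff (μ := μ) hm S).1 <| .of_forall fun x => by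
    rw [lmarginal_const_mul hdep hf]
    by_cases hx : x ∈ B
    · have hx' : lmarginal μ S f x = 0 := hx
      simp [hx']
    · simp [hx]
  filter_upwards [h0, hpos] with x hx hfx hxB
  have : x ∈ B := hxB
  simp [this, hfx] at hx

/-- A finite fibre integral leaves `f` infinite only on a null part of the fibre, so the indicator
of the infinite set has zero marginal. -/
theorem ne_top_ae_of_lmarginal {f : (∀ v, X v) → ℝ≥0∞} (hf : Measurable f) (S : Finset V)
    (hfin : ∀ᵐ x ∂Measure.pi μ, lmarginal μ S f x ≠ ∞) : ∀ᵐ x ∂Measure.pi μ, f x ≠ ∞ := by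
  set B : Set (∀ v, X v) := {x | f x = ∞}
  have hB : MeasurableSet B := hf (measurableSet_singleton ∞)
  have hm : Measurable (B.indicator (1 : (∀ v, X v) → ℝ≥0∞)) := measurable_one.indicator hB
  have h0 := (lmarginal_ae_eq_zero_iff (μ := μ) hm S).1 <| by
    filter_upwards [hfin] with x hx
    refine (lintegral_eq_zero_iff (hm.comp measurable_updateFinset)).2 ?_
    filter_upwards [ae_lt_top (hf.comp measurable_updateFinset) hx] with y hy
    have : Function.updateFinset x S y ∉ B := fun h => hy.ne h
    simp [this]
  filter_upwards [h0] with x hx hxB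
  have : x ∈ B := hxB
  simp [this] at hx

theorem lmarginal_ne_top_ae_of_subset {f : (∀ v, X v) → ℝ≥0∞} (hf : Measurable f)
    {S T : Finset V} (hST : S ⊆ T) (hfin : ∀ᵐ x ∂Measure.pi μ, lmarginal μ T f x ≠ ∞) :
    ∀ᵐ x ∂Measure.pi μ, lmarginal μ S f x ≠ ∞ := by
  rw [← lmarginal_lmarginal_sdiff hf hST] at hfin
  exact ne_top_ae_of_lmarginal (hf.lmarginal μ) _ hfin

end Marginals

/-! ### Conditional kernels -/

section ConditionalKernels

variable {V : Type*} [DecidableEq V] {X : V → Type*} [∀ v, MeasurableSpace (X v)]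
  {μ : ∀ v, Measure (X v)} [∀ v, SigmaFinite (μ v)] {R C : Finset V} {q : (∀ v, X v) → ℝ≥0∞}
  {v a b : V}

theorem measurable_kernelCond (hq : Measurable q) : Measurable (kernelCond μ R q v C) :=
  (hq.lmarginal μ).div (hq.lmarginal μ)

theorem kernelMargin_singleton_lmarginal (hq : Measurable q) (hv : v ∈ R) (hvC : v ∉ C) :
    lmarginal μ {v} (kernelMargin μ R q (insert v C)) = kernelMargin μ R q C := by
  have h : R \ insert v C ⊆ R \ C := Finset.sdiff_subset_sdiff subset_rfl (Finset.subset_insert _ _)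
  have h' : {v} = (R \ C) \ (R \ insert v C) := by
    ext u
    simp only [Finset.mem_singleton, Finset.mem_sdiff, Finset.mem_insert]
    constructor
    · rintro rfl
      simp [hv, hvC]
    · tauto
  rw [kernelMargin, kernelMargin, h', lmarginal_lmarginal_sdiff hq h]

variable [Fintype V]

section Positive

variable (hq : Measurable q) (hpos : ∀ᵐ x ∂Measure.pi μ, q x ≠ 0)
  (hfin : ∀ᵐ x ∂Measure.pi μ, lmarginal μ R q x ≠ ∞)

include hq hpos in
theorem kernelMargin_ne_zero_ae (T : Finset V) :
    ∀ᵐ x ∂Measure.pi μ, kernelMargin μ R q T x ≠ 0 :=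
  lmarginal_ne_zero_ae hq hpos _

include hq hfin in
theorem kernelMargin_ne_top_ae (T : Finset V) :
    ∀ᵐ x ∂Measure.pi μ, kernelMargin μ R q T x ≠ ∞ :=
  lmarginal_ne_top_ae_of_subset hq Finset.sdiff_subset hfin

include hq hpos hfin

theorem kernelCond_ne_zero_ae : ∀ᵐ x ∂Measure.pi μ, kernelCond μ R q v C x ≠ 0 := by
  filter_upwards [kernelMargin_ne_zero_ae (R := R) hq hpos (insert v C),
    kernelMargin_ne_top_ae hq hfin C] with x h₁ h₂
  exact ENNReal.div_ne_zero.2 ⟨h₁, h₂⟩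

theorem kernelCond_ne_top_ae : ∀ᵐ x ∂Measure.pi μ, kernelCond μ R q v C x ≠ ∞ := by
  filter_upwards [kernelMargin_ne_zero_ae (R := R) hq hpos C,
    kernelMargin_ne_top_ae hq hfin (insert v C)] with x h₁ h₂
  exact ENNReal.div_ne_top h₂ h₁

theorem div_kernelCond_ne_zero_ae :
    ∀ᵐ x ∂Measure.pi μ, q x / kernelCond μ R q v C x ≠ 0 := by
  filter_upwards [hpos, kernelCond_ne_top_ae (v := v) (C := C) hq hpos hfin] with x h₁ h₂
  exact ENNReal.div_ne_zero.2 ⟨h₁, h₂⟩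

/-- If the kernel obtained by fixing `v` does not depend on `v`, fixing `v` amounts to
marginalizing over `v`. -/
theorem lmarginal_ae_eq_of_div_kernelCond {h : (∀ v, X v) → ℝ≥0∞} (hv : v ∈ R) (hvC : v ∉ C)
    (hdep : DependsOn h ({v} : Set V)ᶜ)
    (heq : (fun x => q x / kernelCond μ R q v C x) =ᵐ[Measure.pi μ] h) :
    lmarginal μ {v} q =ᵐ[Measure.pi μ] h := by
  have hq' : q =ᵐ[Measure.pi μ] fun x => h x * kernelCond μ R q v C x := by
    filter_upwards [heq, kernelCond_ne_zero_ae (v := v) (C := C) hq hpos hfin,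
      kernelCond_ne_top_ae (v := v) (C := C) hq hpos hfin] with x h₀ h₁ h₂
    rw [← h₀, ENNReal.div_mul_cancel h₁ h₂]
  have hinv : DependsOn (fun x => (kernelMargin μ R q C x)⁻¹) (↑({v} : Finset V) : Set V)ᶜ := by
    intro x y hxy
    have : DependsOn (kernelMargin μ R q C) (↑({v} : Finset V) : Set V)ᶜ :=
      (dependsOn_lmarginal_compl _ _).mono <| Set.compl_subset_compl.2 <| by
        simp [hv, hvC]
    simp only [this hxy]
  -- The conditional kernel has mass one in `v`; the quotient stays unsimplified because the margin
  -- is nonzero and finite only almost everywhere.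
  have hcond : lmarginal μ {v} (kernelCond μ R q v C) =
      fun x => (kernelMargin μ R q C x)⁻¹ * kernelMargin μ R q C x := by
    have : kernelCond μ R q v C =
        fun x => (kernelMargin μ R q C x)⁻¹ * kernelMargin μ R q (insert v C) x := by
      ext x
      rw [kernelCond, ENNReal.div_eq_inv_mul]
    have hm : Measurable (kernelMargin μ R q (insert v C)) := hq.lmarginal μ
    rw [this, lmarginal_const_mul hinv hm,
      kernelMargin_singleton_lmarginal hq hv hvC]
  refine (hq'.lmarginal {v}).trans ?_
  rw [lmarginal_const_mul (by simpa using hdep) (measurable_kernelCond hq), hcond]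
  filter_upwards [kernelMargin_ne_zero_ae (R := R) hq hpos C,
    kernelMargin_ne_top_ae hq hfin C] with x h₁ h₂
  rw [ENNReal.inv_mul_cancel h₁ h₂, mul_one]

/-- Fixing a variable does not change the total mass. -/
theorem lmarginal_div_kernelCond (hvC : v ∉ C) :
    lmarginal μ (R.erase v) (fun x => q x / kernelCond μ R q v C x) =ᵐ[Measure.pi μ]
      lmarginal μ R q := by
  have hm : Measurable fun x => q x / kernelCond μ R q v C x := hq.div (measurable_kernelCond hq)
  -- Integrate first over the variables outside `insert v C`, on which the conditional kernel does
  -- not depend. The result is the margin on `C`, with `v` already gone; only `R ∩ C` remains to be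
  -- integrated.
  have h₁ : lmarginal μ (R \ insert v C) (fun x => q x / kernelCond μ R q v C x) =ᵐ[Measure.pi μ]
      kernelMargin μ R q C := by
    have hinv : DependsOn (fun x => (kernelCond μ R q v C x)⁻¹)
        (↑(R \ insert v C) : Set V)ᶜ := by
      have hN : DependsOn (kernelMargin μ R q (insert v C)) (↑(R \ insert v C) : Set V)ᶜ :=
        dependsOn_lmarginal_compl _ _
      have hD : DependsOn (kernelMargin μ R q C) (↑(R \ insert v C) : Set V)ᶜ :=
        (dependsOn_lmarginal_compl _ _).mono <| Set.compl_subset_compl.2 <|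
          Finset.coe_subset.2 <| Finset.sdiff_subset_sdiff subset_rfl (Finset.subset_insert _ _)
      intro x y hxy
      simp only [kernelCond, hN hxy, hD hxy]
    have : (fun x => q x / kernelCond μ R q v C x) =
        fun x => (kernelCond μ R q v C x)⁻¹ * q x := by
      ext x
      rw [ENNReal.div_eq_inv_mul]
    rw [this, lmarginal_const_mul hinv hq]
    filter_upwards [kernelMargin_ne_zero_ae (R := R) hq hpos (insert v C),
      kernelMargin_ne_top_ae hq hfin (insert v C)] with x h₁ h₂
    change (kernelMargin μ R q (insert v C) x / kernelMargin μ R q C x)⁻¹ *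
      kernelMargin μ R q (insert v C) x = _
    rw [ENNReal.inv_div (.inr h₂) (.inr h₁), ENNReal.div_mul_cancel h₁ h₂]
  have hsub : R \ insert v C ⊆ R.erase v := fun u hu => by
    simp only [Finset.mem_sdiff, Finset.mem_insert, not_or] at hu
    exact Finset.mem_erase.2 ⟨hu.2.1, hu.1⟩
  have hsdiff : R.erase v \ (R \ insert v C) = R \ (R \ C) := by
    ext u
    simp only [Finset.mem_sdiff, Finset.mem_erase, Finset.mem_insert]
    have : u ∈ C → u ≠ v := fun h h' => hvC (h' ▸ h)
    tauto
  rw [← lmarginal_lmarginal_sdiff hm hsub, hsdiff,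
    ← lmarginal_lmarginal_sdiff hq (Finset.sdiff_subset (s := R) (t := C))]
  exact h₁.lmarginal _

theorem KernelIndep.kernelCond_ae_eq (h : KernelIndep μ R q a b C) :
    kernelCond μ R q a C =ᵐ[Measure.pi μ] kernelCond μ R q a (insert b C) := by
  filter_upwards [h, kernelMargin_ne_zero_ae (R := R) hq hpos C, kernelMargin_ne_top_ae hq hfin C,
    kernelMargin_ne_zero_ae (R := R) hq hpos (insert b C),
    kernelMargin_ne_top_ae hq hfin (insert b C)] with x h₀ h₁ h₂ h₃ h₄
  rw [kernelCond, kernelCond, ENNReal.div_eq_div_iff h₃ h₄ h₁ h₂, mul_comm, ← h₀, mul_comm]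

end Positive

theorem KernelIndep.congr {q' : (∀ v, X v) → ℝ≥0∞} (hqq' : q =ᵐ[Measure.pi μ] q')
    (h : KernelIndep μ R q a b C) : KernelIndep μ R q' a b C := by
  filter_upwards [h, hqq'.lmarginal (R \ insert a (insert b C)), hqq'.lmarginal (R \ C),
    hqq'.lmarginal (R \ insert a C), hqq'.lmarginal (R \ insert b C)] with x h₀ h₁ h₂ h₃ h₄
  simpa only [kernelMargin, h₁, h₂, h₃, h₄] using h₀

/-- Integrating `b` acts on `g` alone and integrating `a` on `f` alone, so both sides of the
independence equation are `f * g` times the two integrals. -/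
theorem kernelIndep_of_margin_eq_mul {f g : (∀ v, X v) → ℝ≥0∞} (hq : Measurable q)
    (ha : a ∈ R) (hb : b ∈ R) (hab : a ≠ b) (haC : a ∉ C) (hbC : b ∉ C)
    (hf : Measurable f) (hg : Measurable g) (hfb : DependsOn f ({b} : Set V)ᶜ)
    (hga : DependsOn g ({a} : Set V)ᶜ)
    (h : kernelMargin μ R q (insert a (insert b C)) =ᵐ[Measure.pi μ] fun x => f x * g x) :
    KernelIndep μ R q a b C := by
  have hfb' : DependsOn f (↑({b} : Finset V) : Set V)ᶜ := by simpa using hfb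
  have hga' : DependsOn g (↑({a} : Finset V) : Set V)ᶜ := by simpa using hga
  have h_a : kernelMargin μ R q (insert a C) =ᵐ[Measure.pi μ]
      fun x => f x * lmarginal μ {b} g x := by
    rw [← lmarginal_const_mul hfb' hg, ← kernelMargin_singleton_lmarginal hq hb
      (show b ∉ insert a C by simp [hbC, hab.symm]), Finset.insert_comm]
    exact h.lmarginal _
  have h_b : kernelMargin μ R q (insert b C) =ᵐ[Measure.pi μ]
      fun x => g x * lmarginal μ {a} f x := by
    rw [← lmarginal_const_mul hga' hf, ← kernelMargin_singleton_lmarginal hq ha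
      (show a ∉ insert b C by simp [haC, hab])]
    simp only [mul_comm (g _)]
    exact h.lmarginal _
  have h_C : kernelMargin μ R q C =ᵐ[Measure.pi μ]
      fun x => lmarginal μ {b} g x * lmarginal μ {a} f x := by
    rw [← lmarginal_const_mul (hga'.lmarginal {b}) hf,
      ← kernelMargin_singleton_lmarginal hq ha haC]
    simp only [mul_comm (lmarginal μ {b} g _)]
    exact h_a.lmarginal _
  filter_upwards [h, h_a, h_b, h_C] with x h₁ h₂ h₃ h₄
  rw [h₁, h₂, h₃, h₄]
  ring

/-- If a margin factorizes into kernels none of which involves both `a` and `b`, then `a` and `b`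
are independent given the other variables of the margin. -/
theorem kernelIndep_of_margin_eq_prod {𝒟 : Finset (Finset V)} {P : Finset V → Finset V}
    {k : Finset V → (∀ v, X v) → ℝ≥0∞} (hq : Measurable q)
    (ha : a ∈ R) (hb : b ∈ R) (hab : a ≠ b) (haC : a ∉ C) (hbC : b ∉ C)
    (hk : ∀ D ∈ 𝒟, IsKernel μ D (P D) (k D))
    (hsep : ∀ D ∈ 𝒟, a ∈ D ∪ P D → b ∉ D ∪ P D)
    (h : kernelMargin μ R q (insert a (insert b C)) =ᵐ[Measure.pi μ]
      fun x => ∏ D ∈ 𝒟, k D x) :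
    KernelIndep μ R q a b C := by
  have hdep : ∀ D ∈ 𝒟, ∀ u, u ∉ D ∪ P D → DependsOn (k D) ({u} : Set V)ᶜ := fun D hD u hu =>
    (hk D hD).dependsOn.mono <| Set.subset_compl_singleton_iff.2 hu
  refine kernelIndep_of_margin_eq_mul hq ha hb hab haC hbC
    (f := fun x => ∏ D ∈ 𝒟 with a ∈ D ∪ P D, k D x)
    (g := fun x => ∏ D ∈ 𝒟 with a ∉ D ∪ P D, k D x) ?_ ?_ ?_ ?_ ?_
  · exact Finset.measurable_prod _ fun D hD => (hk D (Finset.mem_filter.1 hD).1).measurable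
  · exact Finset.measurable_prod _ fun D hD => (hk D (Finset.mem_filter.1 hD).1).measurable
  · exact dependsOn_finsetProd _ fun D hD => by
      obtain ⟨hD, haD⟩ := Finset.mem_filter.1 hD
      exact hdep D hD b (hsep D hD haD)
  · exact dependsOn_finsetProd _ fun D hD => by
      obtain ⟨hD, haD⟩ := Finset.mem_filter.1 hD
      exact hdep D hD a haD
  · simpa only [Finset.prod_filter_mul_prod_filter_not] using h

end ConditionalKernels

/-! ### Fixing sequences, districts and intrinsic sets -/

namespace CADMG

section Fixing

variable {V : Type*}

theorem fixable_of_childless {G : CADMG V} {v : V} (hv : v ∈ G.rand) (h : ∀ u, ¬ G.dir v u) :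
    G.Fixable v :=
  ⟨hv, fun _ _ _ hu => by
    obtain ⟨w, hw, -⟩ := Relation.TransGen.head'_iff.1 hu.1
    exact h w hw⟩

variable [DecidableEq V]

theorem fixSet_fixSet (G : CADMG V) (S T : Finset V) :
    (G.fixSet S).fixSet T = G.fixSet (S ∪ T) := by
  simp only [fixSet, CADMG.mk.injEq, sdiff_sdiff_left, Finset.sup_eq_union, true_and]
  constructor <;> ext u v <;> simp only [Finset.mem_union] <;> tauto

theorem fixSet_empty (G : CADMG V) : G.fixSet ∅ = G := by
  cases G
  simp [fixSet]

/-- The order of fixing matters for validity only, not for the resulting graph. -/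
theorem fixSeq_eq_fixSet (G : CADMG V) (l : List V) : G.fixSeq l = G.fixSet l.toFinset := by
  induction l generalizing G with
  | nil => simp [fixSeq, fixSet_empty]
  | cons v l ih => rw [fixSeq, ih, fixSet_fixSet, List.toFinset_cons, Finset.insert_eq]

theorem fixSeq_append (G : CADMG V) (l l' : List V) :
    G.fixSeq (l ++ l') = (G.fixSeq l).fixSeq l' := by
  induction l generalizing G with
  | nil => rfl
  | cons v l ih => exact ih _

theorem validFixing_append {G : CADMG V} {l l' : List V} :
    G.ValidFixing (l ++ l') ↔ G.ValidFixing l ∧ (G.fixSeq l).ValidFixing l' := by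
  induction l generalizing G with
  | nil => simp [ValidFixing, fixSeq]
  | cons v l ih => simp only [List.cons_append, ValidFixing, fixSeq, ih, and_assoc]

/-- `S` is the set fixed before the turn of `v`. -/
theorem ValidFixing.exists_fixable {G : CADMG V} {l : List V} (hl : G.ValidFixing l) {v : V}
    (hv : v ∈ l) : ∃ S ⊆ l.toFinset, (G.fixSet S).Fixable v := by
  obtain ⟨l₁, l₂, rfl⟩ := List.append_of_mem hv
  refine ⟨l₁.toFinset, fun u hu => by simp_all, ?_⟩
  rw [← fixSeq_eq_fixSet]
  exact (validFixing_append.1 hl).2.1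

end Fixing

section Districts

variable {V : Type*} {G : CADMG V} {D : Finset V} {u v w : V}

theorem mem_district : u ∈ G.district v ↔ u ∈ G.rand ∧ Relation.ReflTransGen G.bi v u := by
  simp [district]

theorem mem_district_self (hv : v ∈ G.rand) : v ∈ G.district v :=
  mem_district.2 ⟨hv, .refl⟩

theorem bi_reflTransGen_symm (h : Relation.ReflTransGen G.bi u v) :
    Relation.ReflTransGen G.bi v u :=
  have : Std.Symm G.bi := ⟨G.bi_symm⟩
  Relation.ReflTransGen.stdSymm.symm _ _ h

theorem bi_transGen_symm (h : Relation.TransGen G.bi u v) : Relation.TransGen G.bi v u :=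
  have : Std.Symm G.bi := ⟨G.bi_symm⟩
  Relation.TransGen.stdSymm.symm _ _ h

section

variable [Fintype V]

theorem mem_parents : u ∈ G.parents D ↔ ∃ v ∈ D, G.dir u v := by
  simp [parents]

theorem exists_maximal_of_nonempty (G : CADMG V) {T : Finset V} (hT : T.Nonempty) :
    ∃ v ∈ T, ∀ u ∈ T, ¬ Relation.TransGen G.dir v u := by
  have : IsStrictOrder V fun u v => Relation.TransGen G.dir v u :=
    { irrefl := G.acyclic
      trans := fun _ _ _ h₁ h₂ => h₂.trans h₁ }
  obtain ⟨v, hv, h⟩ := (Finite.wellFounded_of_trans_of_irrefl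
    fun u v => Relation.TransGen G.dir v u).has_min (↑T : Set V) hT
  exact ⟨v, hv, h⟩

end

variable [DecidableEq V]

theorem bi_reflTransGen_of_mem_districts (hD : D ∈ G.districts) (hu : u ∈ D) (hv : v ∈ D) :
    Relation.ReflTransGen G.bi u v := by
  obtain ⟨w, -, rfl⟩ := Finset.mem_image.1 hD
  exact (bi_reflTransGen_symm (mem_district.1 hu).2).trans (mem_district.1 hv).2

theorem subset_rand_of_mem_districts (hD : D ∈ G.districts) : D ⊆ G.rand := by
  obtain ⟨w, -, rfl⟩ := Finset.mem_image.1 hD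
  exact fun u hu => (mem_district.1 hu).1

theorem mem_of_bi_reflTransGen (hD : D ∈ G.districts) (hu : u ∈ D) (hv : v ∈ G.rand)
    (h : Relation.ReflTransGen G.bi u v) : v ∈ D := by
  obtain ⟨w, -, rfl⟩ := Finset.mem_image.1 hD
  exact mem_district.2 ⟨hv, (mem_district.1 hu).2.trans h⟩

theorem district_mem_districts (hv : v ∈ G.rand) : G.district v ∈ G.districts :=
  Finset.mem_image_of_mem _ hv

theorem district_eq_of_mem (hD : D ∈ G.districts) (hu : u ∈ D) : G.district u = D := by
  ext v
  rw [mem_district]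
  exact ⟨fun h => mem_of_bi_reflTransGen hD hu h.1 h.2,
    fun h => ⟨subset_rand_of_mem_districts hD h, bi_reflTransGen_of_mem_districts hD hu h⟩⟩

theorem nonempty_of_mem_districts (hD : D ∈ G.districts) : D.Nonempty := by
  obtain ⟨w, hw, rfl⟩ := Finset.mem_image.1 hD
  exact ⟨w, mem_district_self hw⟩

/-- Fixing vertices outside of a district does not change the district. -/
theorem mem_districts_fixSet {S : Finset V} (hD : D ∈ G.districts) (hS : Disjoint S D) :
    D ∈ (G.fixSet S).districts := by
  obtain ⟨w, hw⟩ := nonempty_of_mem_districts hD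
  have hmem : ∀ {u}, u ∈ D → u ∈ (G.fixSet S).rand := fun hu => Finset.mem_sdiff.2
    ⟨subset_rand_of_mem_districts hD hu, fun hS' => Finset.disjoint_left.1 hS hS' hu⟩
  suffices h : (G.fixSet S).district w = D from h ▸ district_mem_districts (hmem hw)
  have hconn : ∀ {u}, Relation.ReflTransGen G.bi w u →
      u ∈ D ∧ Relation.ReflTransGen (G.fixSet S).bi w u := by
    intro u hu
    induction hu with
    | refl => exact ⟨hw, .refl⟩
    | @tail b c _ hbc ih =>
      have hc : c ∈ D := mem_of_bi_reflTransGen hD ih.1 (G.bi_rand _ _ (G.bi_symm _ _ hbc))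
        (.single hbc)
      exact ⟨hc, ih.2.tail ⟨hbc, (Finset.mem_sdiff.1 (hmem ih.1)).2,
        (Finset.mem_sdiff.1 (hmem hc)).2⟩⟩
  ext u
  rw [mem_district]
  refine ⟨fun h => (hconn (Relation.ReflTransGen.mono (fun _ _ h => h.1) _ _ h.2)).1, fun h => ?_⟩
  exact ⟨hmem h, (hconn (bi_reflTransGen_of_mem_districts hD hw h)).2⟩

/-- The complement of a district can be fixed. -/
theorem exists_validFixing_of_mem_districts [Fintype V] (hD : D ∈ G.districts) :
    ∃ l, G.ValidFixing l ∧ l.toFinset = G.rand \ D ∧ (G.fixSeq l).districts = {D} := by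
  induction hn : (G.rand \ D).card generalizing G with
  | zero =>
    have hempty := Finset.card_eq_zero.1 hn
    refine ⟨[], trivial, by simp [hempty], Finset.eq_singleton_iff_unique_mem.2 ⟨hD, ?_⟩⟩
    intro D' hD'
    obtain ⟨w, hw⟩ := nonempty_of_mem_districts hD'
    have hwD : w ∈ D := Finset.sdiff_eq_empty_iff_subset.1 hempty
      (subset_rand_of_mem_districts hD' hw)
    rw [← district_eq_of_mem hD hwD]
    exact (district_eq_of_mem hD' hw).symm
  | succ n ih =>
    obtain ⟨v, hv, hmax⟩ := G.exists_maximal_of_nonempty (T := G.rand \ D)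
      (Finset.card_pos.1 (by omega))
    obtain ⟨hvR, hvD⟩ := Finset.mem_sdiff.1 hv
    -- All descendants of `v` lie in `D` by maximality, while a bidirected path into `D` would put
    -- `v` itself into the district.
    have hfix : G.Fixable v := ⟨hvR, fun u hu _ huv => by
      by_cases huD : u ∈ D
      · exact hvD (mem_of_bi_reflTransGen hD huD hvR (bi_reflTransGen_symm huv.2.to_reflTransGen))
      · exact hmax u (Finset.mem_sdiff.2 ⟨hu, huD⟩) huv.1⟩
    have hrand : (G.fixSet {v}).rand \ D = (G.rand \ D).erase v := by
      ext u
      simp only [fixSet, Finset.mem_sdiff, Finset.mem_erase, Finset.mem_singleton]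
      tauto
    obtain ⟨l, hl, hlD, hld⟩ := ih (mem_districts_fixSet hD (Finset.disjoint_singleton_left.2 hvD))
      (by rw [hrand, Finset.card_erase_of_mem hv, hn, Nat.add_sub_cancel])
    refine ⟨v :: l, ⟨hfix, hl⟩, ?_, hld⟩
    rw [List.toFinset_cons, hlD, hrand, Finset.insert_erase hv]

variable [Fintype V]

/-- The districts that occur along a valid fixing sequence are intrinsic. -/
theorem intrinsic_of_mem_districts (hG : G.IsADMG) {l : List V} (hl : G.ValidFixing l)
    (hD : D ∈ (G.fixSeq l).districts) : G.Intrinsic D := by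
  obtain ⟨l', hl', hlD, hd⟩ := exists_validFixing_of_mem_districts hD
  refine ⟨l ++ l', validFixing_append.2 ⟨hl, hl'⟩, ?_, by rw [fixSeq_append, hd]⟩
  have hsub := subset_rand_of_mem_districts hD
  have hrand : (G.fixSeq l).rand = Finset.univ \ l.toFinset := by
    rw [fixSeq_eq_fixSet, ← hG]
    rfl
  rw [List.toFinset_append, hlD, hrand]
  rw [hrand] at hsub
  ext u
  have := @hsub u
  simp only [Finset.mem_union, Finset.mem_sdiff, Finset.mem_univ, true_and] at this ⊢
  tauto

/-- If `p(V \ {m} | do(m))` is identified, then `m` has no bidirected edge into the district of its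
child. -/
theorem Identified.not_bi {m y b : V} (h : G.Identified {m}) (hmy : G.dir m y)
    (hyb : Relation.ReflTransGen (G.fixSet {m}).bi y b) : ¬ G.bi m b := by
  intro hmb
  have hym : y ≠ m := by
    rintro rfl
    exact G.acyclic y (.single hmy)
  have hy : y ∈ (G.fixSet {m}).rand :=
    Finset.mem_sdiff.2 ⟨G.dir_rand _ _ hmy, by simpa using hym⟩
  obtain ⟨l, hl, hlD, -⟩ := h _ (district_mem_districts hy)
  have hmem : ∀ u, u ∈ l ↔ u ∉ (G.fixSet {m}).district y := fun u => by
    rw [← List.mem_toFinset, hlD]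
    simp
  have hm : m ∈ l := (hmem m).2 fun hm => by
    simpa [fixSet] using (mem_district.1 hm).1
  -- When `m` is fixed, no vertex of the district of `y` has been fixed, so the bidirected path from
  -- `y` to `b` is still intact. With `m ↔ b` and `m → y` it contradicts fixability of `m`.
  obtain ⟨S, hS, hfix⟩ := hl.exists_fixable hm
  have hSD : ∀ {u}, u ∈ (G.fixSet {m}).district y → u ∉ S := fun hu hu' =>
    (hmem _).1 (List.mem_toFinset.1 (hS hu')) hu
  have hyS := hSD (mem_district_self hy)
  have hconn : b ∈ (G.fixSet {m}).district y ∧ Relation.ReflTransGen (G.fixSet S).bi y b := by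
    clear hmb
    induction hyb with
    | refl => exact ⟨mem_district_self hy, .refl⟩
    | @tail b c hb hbc ih =>
      have hc : c ∈ (G.fixSet {m}).district y :=
        mem_district.2 ⟨(G.fixSet {m}).bi_rand _ _ ((G.fixSet {m}).bi_symm _ _ hbc), hb.tail hbc⟩
      exact ⟨hc, ih.2.tail ⟨hbc.1, hSD ih.1, hSD hc⟩⟩
  have hmS : m ∉ S := (Finset.mem_sdiff.1 hfix.1).2
  refine hfix.2 y (Finset.mem_sdiff.2 ⟨G.dir_rand _ _ hmy, hyS⟩) hym
    ⟨.single ⟨hmy, hyS⟩, ?_⟩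
  exact .head' ⟨hmb, hmS, hSD hconn.1⟩ (bi_reflTransGen_symm hconn.2)

theorem notMem_mb (G : CADMG V) (v : V) : v ∉ G.mb v := Finset.notMem_erase _ _

theorem mem_mb : u ∈ G.mb v ↔ u ≠ v ∧ (u ∈ G.district v ∨ ∃ w ∈ G.district v, G.dir u w) := by
  simp [mb, mem_parents]

end Districts

end CADMG

/-! ### Independence in nested Markov models -/

section NestedMarkov

variable {V : Type*} [Fintype V] [DecidableEq V] {X : V → Type*} [∀ v, MeasurableSpace (X v)]
  {μ : ∀ v, Measure (X v)} {p : (∀ v, X v) → ℝ≥0∞} {G : CADMG V}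

/-- The closed set `S` of bidirected connections separates the families of `a` and `b` after the
vertices of `l` are fixed: no district of the resulting CADMG involves both `a` and `b`. -/
theorem CADMG.notMem_of_separated {l : List V} {a b : V} (S : Set V)
    (hS : ∀ u w, (G.fixSeq l).bi u w → u ∈ S → w ∈ S)
    (ha : ∀ u ∈ (G.fixSeq l).rand, u = a ∨ G.dir a u → u ∈ S)
    (hb : ∀ u ∈ (G.fixSeq l).rand, u = b ∨ G.dir b u → u ∉ S)
    {D : Finset V} (hD : D ∈ (G.fixSeq l).districts) (haD : a ∈ D ∪ G.parents D) :
    b ∉ D ∪ G.parents D := by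
  have hfam : ∀ {c}, c ∈ D ∪ G.parents D → ∃ u ∈ D, u = c ∨ G.dir c u := by
    intro c hc
    rcases Finset.mem_union.1 hc with h | h
    · exact ⟨c, h, .inl rfl⟩
    · obtain ⟨u, hu, hcu⟩ := CADMG.mem_parents.1 h
      exact ⟨u, hu, .inr hcu⟩
  intro hbD
  obtain ⟨u, hu, hau⟩ := hfam haD
  obtain ⟨w, hw, hbw⟩ := hfam hbD
  have hsub := CADMG.subset_rand_of_mem_districts hD
  refine hb w (hsub hw) hbw ?_
  have hconn := CADMG.bi_reflTransGen_of_mem_districts hD hu hw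
  clear hbw hw
  induction hconn with
  | refl => exact ha u (hsub hu) hau
  | tail _ h ih => exact hS _ _ h ih

/-- A vertex outside of `D` without random children does not occur in the kernel of `D`. -/
theorem CADMG.notMem_union_parents {l : List V} {v : V}
    (hv : v ∉ (G.fixSeq l).rand) (hch : ∀ u ∈ (G.fixSeq l).rand, ¬ G.dir v u)
    {D : Finset V} (hD : D ∈ (G.fixSeq l).districts) : v ∉ D ∪ G.parents D := by
  have hsub := CADMG.subset_rand_of_mem_districts hD
  rw [Finset.mem_union, CADMG.mem_parents]
  rintro (h | ⟨u, hu, h⟩)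
  · exact hv (hsub h)
  · exact hch u (hsub hu) h

theorem fixKernel_append_singleton (G : CADMG V) (l : List V) (v : V) (q : (∀ v, X v) → ℝ≥0∞) :
    fixKernel μ G (l ++ [v]) q = fun x => fixKernel μ G l q x /
      kernelCond μ (G.fixSeq l).rand (fixKernel μ G l q) v ((G.fixSeq l).mb v) x := by
  induction l generalizing G q with
  | nil => rfl
  | cons w l ih => exact ih _ _

variable [∀ v, SigmaFinite (μ v)]

/-- Measurability, positivity and finite mass are preserved by fixing. -/
theorem fixKernel_regular {l : List V} {q : (∀ v, X v) → ℝ≥0∞} (hl : G.ValidFixing l)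
    (hq : Measurable q) (hpos : ∀ᵐ x ∂Measure.pi μ, q x ≠ 0)
    (hfin : ∀ᵐ x ∂Measure.pi μ, lmarginal μ G.rand q x ≠ ∞) :
    Measurable (fixKernel μ G l q) ∧ (∀ᵐ x ∂Measure.pi μ, fixKernel μ G l q x ≠ 0) ∧
      ∀ᵐ x ∂Measure.pi μ, lmarginal μ (G.fixSeq l).rand (fixKernel μ G l q) x ≠ ∞ := by
  induction l generalizing G q with
  | nil => exact ⟨hq, hpos, hfin⟩
  | cons v l ih =>
    refine ih hl.2 (hq.div (measurable_kernelCond hq))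
      (div_kernelCond_ne_zero_ae hq hpos hfin) ?_
    have hrand : (G.fixSet {v}).rand = G.rand.erase v := Finset.sdiff_singleton_eq_erase _ _
    filter_upwards [hfin, lmarginal_div_kernelCond hq hpos hfin (G.notMem_mb v)] with x h₁ h₂
    rwa [hrand, h₂]

theorem IsPosDensity.lmarginal_univ_ne_top (hp : IsPosDensity μ p) :
    ∀ᵐ x ∂Measure.pi μ, lmarginal μ Finset.univ p x ≠ ∞ := by
  simp [lmarginal_univ, hp.lintegral_eq_one]

theorem IsPosDensity.fixKernel_regular (hp : IsPosDensity μ p) (hG : G.IsADMG) {l : List V}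
    (hl : G.ValidFixing l) :
    Measurable (fixKernel μ G l p) ∧ (∀ᵐ x ∂Measure.pi μ, fixKernel μ G l p x ≠ 0) ∧
      ∀ᵐ x ∂Measure.pi μ, lmarginal μ (G.fixSeq l).rand (fixKernel μ G l p) x ≠ ∞ := by
  refine _root_.fixKernel_regular hl hp.measurable (hp.pos.mono fun _ h => h.ne') ?_
  rw [hG]
  exact hp.lmarginal_univ_ne_top

/-- In a nested Markov model, fixing a childless vertex amounts to marginalizing over it. -/
theorem NestedMarkov.lmarginal_fixKernel (hp : IsPosDensity μ p) (hG : G.IsADMG)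
    (h : NestedMarkov μ p G) {l : List V} {v : V} (hl : G.ValidFixing (l ++ [v]))
    (hch : ∀ u, ¬ (G.fixSeq l).dir v u) :
    lmarginal μ {v} (fixKernel μ G l p) =ᵐ[Measure.pi μ] fixKernel μ G (l ++ [v]) p := by
  obtain ⟨k, hk, hfac⟩ := h
  obtain ⟨hl₁, hl₂⟩ := CADMG.validFixing_append.1 hl
  obtain ⟨hm, hpos, hfin⟩ := hp.fixKernel_regular hG hl₁
  have hv : v ∈ (G.fixSeq l).rand := hl₂.1.1
  have hvr : v ∉ (G.fixSeq (l ++ [v])).rand := by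
    rw [CADMG.fixSeq_append]
    exact fun hv => (Finset.mem_sdiff.1 hv).2 (Finset.mem_singleton_self v)
  have hvch : ∀ u ∈ (G.fixSeq (l ++ [v])).rand, ¬ G.dir v u := by
    intro u hu hvu
    rw [CADMG.fixSeq_append] at hu
    have hu' : u ∈ (G.fixSeq l).rand := (Finset.mem_sdiff.1 hu).1
    refine hch u ?_
    rw [CADMG.fixSeq_eq_fixSet] at hu' ⊢
    exact ⟨hvu, (Finset.mem_sdiff.1 hu').2⟩
  refine (lmarginal_ae_eq_of_div_kernelCond hm hpos hfin hv ((G.fixSeq l).notMem_mb v) ?_ ?_).trans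
    (hfac _ hl).symm
  -- Once fixed, the childless `v` is neither in a district nor a parent of one, so the factorized
  -- kernel is constant in `v`.
  · exact dependsOn_finsetProd _ fun D hD =>
      (hk D (CADMG.intrinsic_of_mem_districts hG hl hD)).dependsOn.mono <|
        Set.subset_compl_singleton_iff.2 <| CADMG.notMem_union_parents hvr hvch hD
  · rw [← fixKernel_append_singleton]
    exact hfac _ hl

/-- Two variables are independent in a margin of a kernel that agrees with the kernel of a valid
fixing sequence, if a bidirectedly closed set separates the variables and their children. -/
theorem NestedMarkov.kernelIndep (hG : G.IsADMG) (h : NestedMarkov μ p G) {R C : Finset V}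
    {q : (∀ v, X v) → ℝ≥0∞} (hq : Measurable q) {l : List V} {a b : V} (hl : G.ValidFixing l)
    (ha : a ∈ R) (hb : b ∈ R) (hab : a ≠ b) (haC : a ∉ C) (hbC : b ∉ C)
    (hmarg : kernelMargin μ R q (insert a (insert b C)) =ᵐ[Measure.pi μ] fixKernel μ G l p)
    (S : Set V) (hS : ∀ u w, (G.fixSeq l).bi u w → u ∈ S → w ∈ S)
    (haS : ∀ u ∈ (G.fixSeq l).rand, u = a ∨ G.dir a u → u ∈ S)
    (hbS : ∀ u ∈ (G.fixSeq l).rand, u = b ∨ G.dir b u → u ∉ S) :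
    KernelIndep μ R q a b C := by
  obtain ⟨k, hk, hfac⟩ := h
  exact kernelIndep_of_margin_eq_prod hq ha hb hab haC hbC
    (fun D hD => hk D (CADMG.intrinsic_of_mem_districts hG hl hD))
    (fun D hD => CADMG.notMem_of_separated S hS haS hbS hD) (hmarg.trans (hfac l hl))

end NestedMarkov

/-! ### Graphs on the anchor, the treatment, the mediator and the outcome -/

namespace FrontDoor

open Var

/-- `Z, A, M, Y` is a topological order of the ADMG `G`, with the edges `A → M` and `M → Y`. -/
structure Ordered (G : CADMG Var) : Prop where
  isADMG : G.IsADMG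
  dir_only : ∀ u v, G.dir u v → (u = Z ∧ v = A) ∨ (u = Z ∧ v = M) ∨ (u = Z ∧ v = Y) ∨
    (u = A ∧ v = M) ∨ (u = A ∧ v = Y) ∨ (u = M ∧ v = Y)
  dir_A_M : G.dir A M
  dir_M_Y : G.dir M Y

variable {G : CADMG Var}

/-- Any edge against the order closes a directed cycle or makes `Z` a descendant of `A`. The last
edge of the path from `A` to `M` can then only start at `A`, and the first edge from `M` can only
end at `Y`. -/
theorem ordered_of_mediates (hG : G.IsADMG) (hM : Mediates G) (hZ : NotConsequence G) :
    Ordered G := by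
  have hAY : Relation.TransGen G.dir A Y := hM.1.trans hM.2
  have hdir : ∀ u v, G.dir u v → (u = Z ∧ v = A) ∨ (u = Z ∧ v = M) ∨ (u = Z ∧ v = Y) ∨
      (u = A ∧ v = M) ∨ (u = A ∧ v = Y) ∨ (u = M ∧ v = Y) := by
    intro u v h
    rcases u <;> rcases v <;> first
      | exact absurd (.single h) (G.acyclic _)
      | exact absurd (Relation.TransGen.single h : Relation.TransGen G.dir A Z) hZ
      | exact absurd (hM.1.tail h) hZ
      | exact absurd (hAY.tail h) hZ
      | exact absurd (hM.1.tail h) (G.acyclic _)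
      | exact absurd (hM.2.tail h) (G.acyclic _)
      | exact absurd (hAY.tail h) (G.acyclic _)
      | simp
  refine ⟨hG, hdir, ?_, ?_⟩
  · obtain ⟨b, hAb, hbM⟩ := Relation.TransGen.tail'_iff.1 hM.1
    rcases Relation.reflTransGen_iff_eq_or_transGen.1 hAb with rfl | hAb
    · exact hbM
    · rcases hdir b M hbM with h | h | h | h | h | h <;> simp at h
      · exact absurd (h ▸ hAb) hZ
      · exact h ▸ hbM
  · obtain ⟨b, hMb, -⟩ := Relation.TransGen.head'_iff.1 hM.2
    rcases hdir M b hMb with h | h | h | h | h | h <;> simp at h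
    exact h ▸ hMb

theorem InPattern.ordered (hG : InPattern G) : Ordered G where
  isADMG := hG.isADMG
  dir_only u v h := by
    rcases hG.dir_only u v h with h | h | h | h <;> simp [h]
  dir_A_M := hG.dir_A_M
  dir_M_Y := hG.dir_M_Y

namespace Ordered

variable (hG : Ordered G)

include hG

theorem mem_rand (v : Var) : v ∈ G.rand := by
  rw [hG.isADMG]
  exact Finset.mem_univ v

theorem not_dir_Z (u : Var) : ¬ G.dir u Z := fun h => by
  simpa using hG.dir_only _ _ h

theorem eq_Z_of_dir_A {u : Var} (h : G.dir u A) : u = Z := by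
  simpa using hG.dir_only _ _ h

theorem eq_Y_of_dir_M {u : Var} (h : G.dir M u) : u = Y := by
  simpa using hG.dir_only _ _ h

theorem not_dir_Y (u : Var) : ¬ G.dir Y u := fun h => by
  simpa using hG.dir_only _ _ h

theorem transGen_dir_M {u : Var} (h : Relation.TransGen G.dir M u) : u = Y := by
  induction h with
  | single h => exact hG.eq_Y_of_dir_M h
  | tail _ h ih => exact absurd (ih ▸ h) (hG.not_dir_Y _)

theorem not_transGen_dir_A_Z : ¬ Relation.TransGen G.dir A Z := fun h => by
  obtain ⟨b, -, hb⟩ := Relation.TransGen.tail'_iff.1 h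
  exact hG.not_dir_Z b hb

theorem eq_of_reflTransGen_dir_A {u : Var} (h : Relation.ReflTransGen G.dir u A) :
    u = Z ∨ u = A := by
  rcases Relation.ReflTransGen.cases_tail h with h | ⟨b, hub, hb⟩
  · exact .inr h.symm
  · rw [hG.eq_Z_of_dir_A hb] at hub
    rcases Relation.ReflTransGen.cases_tail hub with h | ⟨c, -, hc⟩
    · exact .inl h.symm
    · exact absurd hc (hG.not_dir_Z c)

end Ordered

/-! ### Open paths -/

/-- Only the arrowhead at `A` matters for open paths, so `Z → A` and `Z ↔ A` are treated as one
case. -/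
theorem exists_edge_of_anchor (h : G.dir Z A ∨ G.bi Z A) :
    ∃ k : EdgeKind, G.HasEdge Z k A ∧ k.headAtEnd := by
  rcases h with h | h
  · exact ⟨.fwd, h, trivial⟩
  · exact ⟨.bidir, h, trivial⟩

theorem not_mSep_of_edge {x y : Var} (hxy : x ≠ y) {k : EdgeKind} (h : G.HasEdge x k y)
    (C : Finset Var) : ¬ G.MSep x y C := fun hs => by
  refine hs ⟨[(k, y)], by simp, by simp, by simpa using hxy, h⟩

/-- A two-edge path through a non-collider outside of `C` is open. -/
theorem not_mSep_of_chain {x v y : Var} (hxvy : [x, v, y].Nodup) {k : EdgeKind}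
    {C : Finset Var} (h₁ : G.HasEdge x k v) (h₂ : G.dir v y) (hv : v ∉ C) : ¬ G.MSep x y C := by
  intro hs
  refine hs ⟨[(k, v), (.fwd, y)], by simp, by simp, by simpa using hxvy, h₁, fun h => h.2.elim,
    fun _ => hv, h₂⟩

/-- A two-edge path through a collider that is an ancestor of `C` is open. -/
theorem not_mSep_of_collider {x v y : Var} (hxvy : [x, v, y].Nodup) {k : EdgeKind}
    {C : Finset Var} (h₁ : G.HasEdge x k v) (hk : k.headAtEnd) (h₂ : G.bi v y)
    (hv : ∃ c ∈ C, Relation.ReflTransGen G.dir v c) : ¬ G.MSep x y C := by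
  intro hs
  refine hs ⟨[(k, v), (.bidir, y)], by simp, by simp, by simpa using hxvy, h₁, fun _ => hv,
    fun h => (h ⟨hk, trivial⟩).elim, h₂⟩

/-- A walk without colliders that starts with an arrowhead at `v` follows a directed path. -/
theorem reflTransGen_of_openWalk_empty {y : Var} {l : List (EdgeKind × Var)} {x v : Var}
    {k : EdgeKind} (hk : k.headAtEnd) (h : G.OpenWalk ∅ x ((k, v) :: l))
    (hl : (((k, v) :: l).map Prod.snd).getLast? = some y) : Relation.ReflTransGen G.dir v y := by
  induction l generalizing x v k with
  | nil =>
    obtain rfl : v = y := by simpa using hl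
    exact .refl
  | cons e l ih =>
    obtain ⟨k', w⟩ := e
    obtain ⟨-, hcol, -, hw⟩ := h
    have hk' : k' = .fwd := by
      cases k' with
      | fwd => rfl
      | bwd => simpa using hcol ⟨hk, trivial⟩
      | bidir => simpa using hcol ⟨hk, trivial⟩
    subst hk'
    have hvw : G.dir v w := by
      cases l with
      | nil => exact hw
      | cons _ _ => exact hw.1
    exact .head hvw (ih (k := .fwd) trivial hw (by simpa using hl))

/-- Nothing points at `Z`, so an open path leaves it with an arrowhead at the next vertex. Without
colliders it continues as a directed path to `A`, whose only ancestors are `Z` and `A`. -/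
theorem Ordered.anchor_of_not_mSep (hG : Ordered G) (h : ¬ G.MSep Z A ∅) :
    G.dir Z A ∨ G.bi Z A := by
  obtain ⟨l, hne, hlast, hnd, hopen⟩ := not_not.1 h
  obtain - | ⟨⟨k, v⟩, l⟩ := l
  · simp at hne
  have hedge : G.HasEdge Z k v := by
    cases l with
    | nil => exact hopen
    | cons _ _ => exact hopen.1
  have hv : v ≠ Z := by
    rintro rfl
    simp at hnd
  have hk : k.headAtEnd := by
    cases k with
    | bwd => exact absurd hedge (hG.not_dir_Z v)
    | _ => trivial
  obtain rfl : v = A := (hG.eq_of_reflTransGen_dir_A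
    (reflTransGen_of_openWalk_empty hk hopen hlast)).resolve_left hv
  cases k with
  | fwd => exact .inl hedge
  | bwd => exact hk.elim
  | bidir => exact .inr hedge

/-- If the only edge at `y` is `m → y`, then the open walks to `y` given a set that contains `m`
start at `m`. -/
theorem eq_of_openWalk {m y : Var} {C : Finset Var} (hm : m ∈ C)
    (hy : ∀ u k, G.HasEdge u k y → u = m ∧ k = .fwd) {l : List (EdgeKind × Var)} {x : Var}
    (hopen : G.OpenWalk C x l) (hlast : (l.map Prod.snd).getLast? = some y) :
    x = m ∧ l = [(.fwd, y)] := by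
  induction l generalizing x with
  | nil => simp at hlast
  | cons e l ih =>
    obtain ⟨k, v⟩ := e
    obtain - | ⟨⟨k', w⟩, l⟩ := l
    · obtain rfl : v = y := by simpa using hlast
      obtain ⟨rfl, rfl⟩ := hy _ _ hopen
      exact ⟨rfl, rfl⟩
    · obtain ⟨-, -, hnc, hw⟩ := hopen
      obtain ⟨rfl, hl⟩ := ih hw (by simpa using hlast)
      obtain ⟨⟨rfl, -⟩, -⟩ : ((k' = .fwd ∧ w = y) ∧ l = []) := by simpa using hl
      -- A longer walk would pass through `m` just before `m → y`, hence as a non-collider, although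
      -- `m ∈ C`.
      exact absurd hm (hnc fun h => h.2)

theorem Ordered.mSep_Z_Y (hG : Ordered G) (hZY : ¬ G.dir Z Y) (hAY : ¬ G.dir A Y)
    (hbi : ∀ u, ¬ G.bi u Y) : G.MSep Z Y {A, M} := by
  rintro ⟨l, -, hlast, -, hopen⟩
  refine absurd (eq_of_openWalk (m := M) (by simp) (fun u k h => ?_) hopen hlast).1 (by simp)
  cases k with
  | fwd =>
    refine ⟨?_, rfl⟩
    rcases hG.dir_only _ _ h with h' | h' | h' | h' | h' | h' <;> simp at h'
    · exact absurd (h' ▸ h) hZY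
    · exact absurd (h' ▸ h) hAY
    · exact h'
  | bwd => exact absurd h (hG.not_dir_Y u)
  | bidir => exact absurd h (hbi u)

/-! ### Admissible graphs -/

/-- The graphical core. The presence of `A ↔ Y` enters as the implication `hAY`, as it comes from
m-connection for admissible graphs and from dependence in `p` for densities. -/
theorem Ordered.inPattern (hG : Ordered G) (hanchor : G.dir Z A ∨ G.bi Z A)
    (hid : G.Identified {M}) (hsep : (G.fixSet {M}).MSep Z Y {M})
    (hAY : ¬ G.dir Z Y → ¬ G.dir A Y → ¬ G.bi Z Y → ¬ G.bi M Y → G.bi A Y) : InPattern G := by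
  have hZYd : ¬ G.dir Z Y := fun h =>
    not_mSep_of_edge (G := G.fixSet {M}) (k := .fwd) (by simp) ⟨h, by simp⟩ _ hsep
  have hZYb : ¬ G.bi Z Y := fun h =>
    not_mSep_of_edge (G := G.fixSet {M}) (k := .bidir) (by simp) ⟨h, by simp, by simp⟩ _ hsep
  have hAYd : ¬ G.dir A Y := fun h => by
    obtain ⟨k, hk, -⟩ := exists_edge_of_anchor (G := G.fixSet {M})
      (hanchor.imp (fun h => ⟨h, by simp⟩) fun h => ⟨h, by simp, by simp⟩)
    exact not_mSep_of_chain (by simp) hk ⟨h, by simp⟩ (by simp) hsep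
  have hMY : ¬ G.bi M Y := hid.not_bi hG.dir_M_Y .refl
  have hAYb := hAY hZYd hAYd hZYb hMY
  -- With `M` fixed, `A` lies in the district of the child `Y`, and so does `Z` if `Z ↔ A`;
  -- identification forbids bidirected edges from `M` to either.
  have hYA : Relation.ReflTransGen (G.fixSet {M}).bi Y A :=
    .single ⟨G.bi_symm _ _ hAYb, by simp, by simp⟩
  have hMA : ¬ G.bi M A := hid.not_bi hG.dir_M_Y hYA
  have hMZ : G.bi A Z → ¬ G.bi M Z := fun h =>
    hid.not_bi hG.dir_M_Y (hYA.tail ⟨h, by simp, by simp⟩)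
  refine ⟨hG.isADMG, hG.dir_A_M, hG.dir_M_Y, hAYb, fun u v h => ?_, fun u v h => ?_, hanchor, ?_⟩
  · rcases hG.dir_only u v h with h' | h' | ⟨rfl, rfl⟩ | h' | ⟨rfl, rfl⟩ | h'
    · simp [h']
    · simp [h']
    · exact absurd h hZYd
    · simp [h']
    · exact absurd h hAYd
    · simp [h']
  · have h' := G.bi_symm _ _ h
    rcases u <;> rcases v <;> first
      | exact absurd h (G.bi_irrefl _)
      | exact absurd h ‹_›
      | exact absurd h' ‹_›
      | simp
  · intro hAM
    by_cases hAZ : G.bi A Z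
    · obtain ⟨b, -, hb⟩ := Relation.TransGen.tail'_iff.1 hAM
      have hb := G.bi_symm _ _ hb
      rcases b
      · exact hMZ hAZ hb
      · exact hMA hb
      · exact G.bi_irrefl _ hb
      · exact hMY hb
    · have : ∀ u, Relation.TransGen G.bi A u → u = A ∨ u = Y := by
        have step : ∀ {u v}, u = A ∨ u = Y → G.bi u v → v = A ∨ v = Y := by
          rintro u v (rfl | rfl) h
          · rcases v
            · exact absurd h hAZ
            · exact .inl rfl
            · exact absurd (G.bi_symm _ _ h) hMA
            · exact .inr rfl
          · rcases v
            · exact absurd (G.bi_symm _ _ h) hZYb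
            · exact .inl rfl
            · exact absurd (G.bi_symm _ _ h) hMY
            · exact .inr rfl
        intro u hu
        induction hu with
        | single h => exact step (.inl rfl) h
        | tail _ h ih => exact step ih h
      simpa using this M hAM

/-- The only descendant of `M` is `Y`, and a bidirected path from `M` to `Y` would extend along `Y ↔
A`. -/
theorem InPattern.fixable_M (hG : InPattern G) : G.Fixable M :=
  ⟨hG.ordered.mem_rand M, fun u _ _ hu => by
    obtain rfl := hG.ordered.transGen_dir_M hu.1
    exact hG.no_path (CADMG.bi_transGen_symm (hu.2.tail (G.bi_symm _ _ hG.bi_A_Y)))⟩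

/-- With `M` fixed, every path from `Z` enters `A` with an arrowhead, and `A` is childless. So `A`
is a collider on it and no ancestor of `M`, which blocks the path. -/
theorem InPattern.mSep (hG : InPattern G) : (G.fixSet {M}).MSep Z Y {M} := by
  rintro ⟨l, hne, hlast, hnd, hopen⟩
  have hA : ∀ u, ¬ (G.fixSet {M}).dir A u := fun u hu => by
    rcases hG.dir_only _ _ hu.1 with h | h | h | h <;> simp at h
    exact hu.2 (by simp [h])
  obtain - | ⟨⟨k, v⟩, l⟩ := l
  · simp at hne
  have hedge : (G.fixSet {M}).HasEdge Z k v := by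
    cases l with
    | nil => exact hopen
    | cons _ _ => exact hopen.1
  obtain ⟨rfl, hk⟩ : v = A ∧ k.headAtEnd := by
    cases k with
    | fwd =>
      refine ⟨?_, trivial⟩
      rcases hG.dir_only _ _ hedge.1 with h | h | h | h <;> simp at h
      · exact h
      · exact absurd h (by simpa using hedge.2)
    | bwd => exact absurd hedge.1 (hG.ordered.not_dir_Z v)
    | bidir =>
      refine ⟨?_, trivial⟩
      have hvM : v ≠ M := by simpa using hedge.2.2
      rcases hG.bi_only _ _ hedge.1 with h | h | h <;> simp at h
      · exact h
      · exact absurd h hvM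
  obtain - | ⟨⟨k', w⟩, l⟩ := l
  · simp at hlast
  obtain ⟨-, hcol, -, hw⟩ := hopen
  have hedge' : (G.fixSet {M}).HasEdge A k' w := by
    cases l with
    | nil => exact hw
    | cons _ _ => exact hw.1
  have hk' : k'.headAtStart := by
    cases k' with
    | fwd => exact absurd hedge' (hA w)
    | _ => trivial
  obtain ⟨c, hc, hAc⟩ := hcol ⟨hk, hk'⟩
  rcases Relation.ReflTransGen.cases_head hAc with rfl | ⟨u, hu, -⟩
  · simp at hc
  · exact hA u hu

theorem InPattern.admissible (hG : InPattern G) : Admissible G := by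
  obtain ⟨k, hk, hke⟩ := exists_edge_of_anchor hG.anchor
  exact
    { isADMG := hG.isADMG
      mediates := ⟨.single hG.dir_A_M, .single hG.dir_M_Y⟩
      notConsequence := hG.ordered.not_transGen_dir_A_Z
      relevant_A := not_mSep_of_edge (by simp) hk _
      relevant_Y := not_mSep_of_collider (by simp) hk hke hG.bi_A_Y ⟨A, by simp, .refl⟩
      identified := fun D hD => CADMG.intrinsic_of_mem_districts hG.isADMG (l := [M])
        ⟨hG.fixable_M, trivial⟩ hD
      mSep := hG.mSep }

theorem Admissible.inPattern (hG : Admissible G) : InPattern G := by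
  have hO := ordered_of_mediates hG.isADMG hG.mediates hG.notConsequence
  refine hO.inPattern (hO.anchor_of_not_mSep hG.relevant_A) hG.identified hG.mSep ?_
  intro hZY hAY hZYb hMYb
  by_contra hAYb
  refine hG.relevant_Y (hO.mSep_Z_Y hZY hAY fun u hu => ?_)
  rcases u
  · exact hZYb hu
  · exact hAYb hu
  · exact hMYb hu
  · exact G.bi_irrefl _ hu

end FrontDoor

/-! ### Independence in nested Markov models for the anchor graphs -/

namespace FrontDoor

open Var

variable {X : Var → Type*} [∀ v, MeasurableSpace (X v)] {μ : ∀ v, Measure (X v)}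
  {p : (∀ v, X v) → ℝ≥0∞} {G : CADMG Var}

theorem Ordered.validFixing_Y (hG : Ordered G) : G.ValidFixing [Y] :=
  ⟨CADMG.fixable_of_childless (hG.mem_rand Y) hG.not_dir_Y, trivial⟩

theorem Ordered.not_dir_M_fixSet_Y (hG : Ordered G) (u : Var) : ¬ (G.fixSet {Y}).dir M u :=
  fun h => h.2 (by simpa using hG.eq_Y_of_dir_M h.1)

theorem Ordered.validFixing_Y_M (hG : Ordered G) : G.ValidFixing [Y, M] :=
  ⟨hG.validFixing_Y.1, CADMG.fixable_of_childless
    (Finset.mem_sdiff.2 ⟨hG.mem_rand M, by simp⟩) hG.not_dir_M_fixSet_Y, trivial⟩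

/-- The rank of a variable in the order `Z, A, M, Y`. -/
def rank : Var → ℕ
  | Z => 0
  | A => 1
  | M => 2
  | Y => 3

theorem Ordered.isTopological_rank (hG : Ordered G) : G.IsTopological rank := by
  refine ⟨fun u v h => ?_, fun u v h => ?_⟩
  · rcases u <;> rcases v <;> simp_all [rank]
  · rcases hG.dir_only u v h with h | h | h | h | h | h <;> obtain ⟨rfl, rfl⟩ := h <;> simp [rank]

theorem gFormula_rank (p : (∀ v, X v) → ℝ≥0∞) :
    gFormula μ p rank {M} = fun x => p x / kernelCond μ Finset.univ p M {A, Z} x := by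
  have : (Finset.univ.filter fun u => rank u < rank M) = {A, Z} := by decide
  ext x
  rw [gFormula, Finset.prod_singleton, this]

variable [∀ v, SigmaFinite (μ v)]

/-- Integrating out `Y` and then `M` amounts to fixing them, each being childless in its turn; no
edge joins the remaining `Z` and `A`. -/
theorem Ordered.densityIndep_Z_A (hp : IsPosDensity μ p) (hG : Ordered G)
    (h : NestedMarkov μ p G) (hd : ¬ G.dir Z A) (hb : ¬ G.bi Z A) : DensityIndep μ p Z A ∅ := by
  have hY : lmarginal μ {Y} p =ᵐ[Measure.pi μ] fixKernel μ G [Y] p :=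
    h.lmarginal_fixKernel hp hG.isADMG (l := []) hG.validFixing_Y hG.not_dir_Y
  have hM : lmarginal μ {M} (fixKernel μ G [Y] p) =ᵐ[Measure.pi μ] fixKernel μ G [Y, M] p :=
    h.lmarginal_fixKernel hp hG.isADMG (l := [Y]) hG.validFixing_Y_M hG.not_dir_M_fixSet_Y
  have hmarg : kernelMargin μ Finset.univ p (insert Z (insert A ∅)) =
      lmarginal μ {M} (lmarginal μ {Y} p) := by
    rw [← lmarginal_union μ p hp.measurable (by simp)]
    rfl
  have hrand : ∀ u ∈ (G.fixSeq [Y, M]).rand, u = Z ∨ u = A := by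
    intro u hu
    simp only [CADMG.fixSeq, CADMG.fixSet, Finset.mem_sdiff, Finset.mem_singleton] at hu
    rcases u <;> simp_all
  refine h.kernelIndep hG.isADMG hp.measurable hG.validFixing_Y_M (by simp) (by simp) (by simp)
    (by simp) (by simp) (hmarg ▸ (hY.lmarginal {M}).trans hM) {Z} ?_ ?_ ?_
  · rintro u w hbi rfl
    rcases hrand w ((G.fixSeq [Y, M]).bi_rand _ _ ((G.fixSeq [Y, M]).bi_symm _ _ hbi)) with rfl | rfl
    · rfl
    · exact absurd hbi.1.1 hb
  · rintro u hu (rfl | hu')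
    · rfl
    · rcases hrand u hu with rfl | rfl
      · rfl
      · exact absurd hu' hd
  · rintro u hu (rfl | hu') huZ
    · simp at huZ
    · obtain rfl : u = Z := huZ
      exact hG.not_dir_Z A hu'

/-- All other variables are conditioned on, so the factorization for the empty fixing sequence
suffices. -/
theorem Ordered.densityIndep_Z_Y (hp : IsPosDensity μ p) (hG : Ordered G)
    (h : NestedMarkov μ p G) (S : Set Var) (hS : ∀ u w, G.bi u w → u ∈ S → w ∈ S)
    (hZ : Z ∈ S) (hZS : ∀ u, G.dir Z u → u ∈ S) (hY : Y ∉ S) :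
    DensityIndep μ p Z Y {A, M} := by
  have huniv : (Finset.univ \ insert Z (insert Y {A, M}) : Finset Var) = ∅ := by decide
  refine h.kernelIndep hG.isADMG hp.measurable (l := []) trivial (by simp) (by simp) (by simp)
    (by simp) (by simp) ?_ S hS ?_ ?_
  · rw [kernelMargin, huniv, lmarginal_empty]
    rfl
  · rintro u - (rfl | hu)
    · exact hZ
    · exact hZS u hu
  · rintro u - (rfl | hu)
    · exact hY
    · exact absurd hu (hG.not_dir_Y u)

theorem Ordered.densityIndep_Z_Y_of_isolated (hp : IsPosDensity μ p) (hG : Ordered G)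
    (h : NestedMarkov μ p G) (hZY : ¬ G.dir Z Y) (hbZ : ¬ G.bi Z Y) (hbA : ¬ G.bi A Y)
    (hbM : ¬ G.bi M Y) : DensityIndep μ p Z Y {A, M} := by
  refine hG.densityIndep_Z_Y hp h {Y}ᶜ ?_ (by simp) ?_ (by simp)
  · rintro u w huw hu rfl
    rcases u
    · exact hbZ huw
    · exact hbA huw
    · exact hbM huw
    · exact hu rfl
  · rintro u hu rfl
    exact hZY hu

/-- Under faithfulness, no ordinary independence separates the anchor from the outcome. -/
theorem Ordered.not_densityIndep_Z_Y (hp : IsPosDensity μ p) (hG : Ordered G)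
    (h : NestedMarkov μ p G) (hanchor : G.dir Z A ∨ G.bi Z A)
    (hdep : ¬ DensityIndep μ p Z Y {A, M}) (hfaith : VermaFaithful μ p G)
    (C : Finset Var) (hZC : Z ∉ C) (hYC : Y ∉ C) : ¬ DensityIndep μ p Z Y C := by
  intro hind
  have hsep := hfaith.ordinary Z Y C (by simp) hZC hYC hind
  obtain ⟨k, hk, hke⟩ := exists_edge_of_anchor hanchor
  have hZYd : ¬ G.dir Z Y := fun h => not_mSep_of_edge (k := .fwd) (by simp) h _ hsep
  have hZYb : ¬ G.bi Z Y := fun h => not_mSep_of_edge (k := .bidir) (by simp) h _ hsep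
  by_cases hMC : M ∈ C
  · by_cases hAC : A ∈ C
    · obtain rfl : C = {A, M} := by
        ext u
        rcases u <;> simp_all
      exact hdep hind
    -- Here `A` is an ancestor of `M ∈ C`, which opens it as a collider; the path through `A → M ↔
    -- Y` is open as well. So `Y` has no bidirected edge.
    · have hAYb : ¬ G.bi A Y := fun h =>
        not_mSep_of_collider (by simp) hk hke h ⟨M, hMC, .single hG.dir_A_M⟩ hsep
      have hMYb : ¬ G.bi M Y := fun h => hsep ⟨[(k, A), (.fwd, M), (.bidir, Y)], by simp, by simp,
        by simp, hk, fun h => h.2.elim, fun _ => hAC, hG.dir_A_M, fun _ => ⟨M, hMC, .refl⟩,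
        fun h => (h ⟨trivial, trivial⟩).elim, h⟩
      exact hdep (hG.densityIndep_Z_Y_of_isolated hp h hZYd hZYb hAYb hMYb)
  · have hZMd : ¬ G.dir Z M := fun h =>
      not_mSep_of_chain (k := .fwd) (by simp) h hG.dir_M_Y hMC hsep
    have hZMb : ¬ G.bi Z M := fun h =>
      not_mSep_of_chain (k := .bidir) (by simp) h hG.dir_M_Y hMC hsep
    by_cases hAC : A ∈ C
    · have hAYb : ¬ G.bi A Y := fun h =>
        not_mSep_of_collider (by simp) hk hke h ⟨A, hAC, .refl⟩ hsep
      have hAMb : ¬ G.bi A M := fun h => hsep ⟨[(k, A), (.bidir, M), (.fwd, Y)], by simp, by simp,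
        by simp, hk, fun _ => ⟨A, hAC, .refl⟩, fun h => (h ⟨hke, trivial⟩).elim, h,
        fun h => h.2.elim, fun _ => hMC, hG.dir_M_Y⟩
      -- All bidirected edges from `{Z, A}` to `{M, Y}` are excluded, and so are the children `M`,
      -- `Y` of `Z`.
      refine hdep (hG.densityIndep_Z_Y hp h {Z, A} ?_ (by simp) ?_ (by simp))
      · rintro u w huw (rfl | rfl) <;> rcases w <;> first | exact absurd huw ‹_› | simp
      · intro u hu
        rcases u <;> first | exact absurd hu ‹_› | simp
    · exact hsep ⟨[(k, A), (.fwd, M), (.fwd, Y)], by simp, by simp, by simp, hk,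
        fun h => h.2.elim, fun _ => hAC, hG.dir_A_M, fun h => h.2.elim, fun _ => hMC, hG.dir_M_Y⟩

/-- Generalized faithfulness turns the Verma constraint into identification and m-separation; the
factorization turns the two assumed dependences into the anchor edge and `A ↔ Y`. -/
theorem inPattern_of_vermaConstraint (hp : IsPosDensity μ p) (hG : Ordered G)
    (h : NestedMarkov μ p G) (hZA : ¬ DensityIndep μ p Z A ∅)
    (hZY : ¬ DensityIndep μ p Z Y {A, M}) (hfaith : VermaFaithful μ p G)
    (hverma : VermaConstraint μ p) : InPattern G := by
  have hanchor : G.dir Z A ∨ G.bi Z A := by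
    by_contra hno
    rw [not_or] at hno
    exact hZA (hG.densityIndep_Z_A hp h hno.1 hno.2)
  have huniv : (Finset.univ \ {M} : Finset Var) = {Z, A, Y} := by decide
  obtain ⟨hid, hsep⟩ := hfaith.generalized rank {M} ∅ Z Y hG.isTopological_rank (by simp) (by simp)
    (by simp) (by simp) (hG.not_densityIndep_Z_Y hp h hanchor hZY hfaith)
    (by rw [huniv, gFormula_rank]; exact hverma)
  refine hG.inPattern hanchor hid (by simpa using hsep) fun hZYd _ hZYb hMYb => ?_
  by_contra hAYb
  exact hZY (hG.densityIndep_Z_Y_of_isolated hp h hZYd hZYb hAYb hMYb)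

theorem InPattern.noBidirectedPathToChild (hG : InPattern G) : NoBidirectedPathToChild G := by
  intro c hc
  obtain rfl : c = M := by simpa using hG.dir_only _ _ hc
  exact hG.no_path

/-! ### The Verma constraint -/

theorem InPattern.eq_Z_of_bi_M (hG : InPattern G) {u : Var} (h : G.bi M u) : u = Z := by
  rcases hG.bi_only _ _ h with h' | h' | h' <;> simp at h'
  exact h'

/-- `Y` stays out of the blanket: it has no children, and in the district of `M` it would link `M`
to `A` by a bidirected path. -/
theorem InPattern.mb_M (hG : InPattern G) (h : G.dir Z M ∨ G.bi Z M) : G.mb M = {A, Z} := by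
  have hM := CADMG.mem_district_self (hG.ordered.mem_rand M)
  ext u
  rw [CADMG.mem_mb]
  rcases u
  · refine iff_of_true ⟨by simp, h.symm.imp (fun h => ?_) fun h => ⟨M, hM, h⟩⟩ (by simp)
    exact CADMG.mem_district.2 ⟨hG.ordered.mem_rand Z, .single (G.bi_symm _ _ h)⟩
  · exact iff_of_true ⟨by simp, .inr ⟨M, hM, hG.dir_A_M⟩⟩ (by simp)
  · simp
  · refine iff_of_false ?_ (by simp)
    rintro ⟨-, hY | ⟨w, -, hw⟩⟩
    · rcases Relation.reflTransGen_iff_eq_or_transGen.1 (CADMG.mem_district.1 hY).2 with h | h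
      · simp at h
      · exact hG.no_path (CADMG.bi_transGen_symm (h.tail (G.bi_symm _ _ hG.bi_A_Y)))
    · exact hG.ordered.not_dir_Y w hw

theorem InPattern.mb_M_of_not (hG : InPattern G) (hd : ¬ G.dir Z M) (hb : ¬ G.bi Z M) :
    G.mb M = {A} := by
  have hM : ∀ u, u ∈ G.district M ↔ u = M := fun u => by
    rw [CADMG.mem_district]
    constructor
    · rintro ⟨-, h⟩
      rcases Relation.ReflTransGen.cases_head h with h | ⟨w, hw, -⟩
      · exact h.symm
      · exact absurd (hG.eq_Z_of_bi_M hw ▸ G.bi_symm _ _ hw) hb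
    · rintro rfl
      exact ⟨hG.ordered.mem_rand M, .refl⟩
  ext u
  simp only [CADMG.mem_mb, hM, exists_eq_left, Finset.mem_singleton]
  rcases u
  · simp [hd]
  · simp [hG.dir_A_M]
  · simp
  · simp [hG.ordered.not_dir_Y]

/-- Without an edge between `Z` and `M`, `M` is independent of `Z` given `A`. -/
theorem InPattern.densityIndep_M_Z (hp : IsPosDensity μ p) (hG : InPattern G)
    (h : NestedMarkov μ p G) (hd : ¬ G.dir Z M) (hb : ¬ G.bi Z M) :
    DensityIndep μ p M Z {A} := by
  have hO := hG.ordered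
  have hmarg : kernelMargin μ Finset.univ p (insert M (insert Z {A})) =
      lmarginal μ {Y} p := rfl
  refine h.kernelIndep hO.isADMG hp.measurable hO.validFixing_Y (by simp) (by simp) (by simp)
    (by simp) (by simp) (hmarg ▸ h.lmarginal_fixKernel hp hO.isADMG (l := []) hO.validFixing_Y
      hO.not_dir_Y) {M} ?_ ?_ ?_
  · rintro u w hbi rfl
    exact absurd (hG.eq_Z_of_bi_M hbi.1 ▸ G.bi_symm _ _ hbi.1) hb
  · rintro u hu (rfl | hu')
    · rfl
    · obtain rfl := hO.eq_Y_of_dir_M hu'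
      simp [CADMG.fixSeq, CADMG.fixSet] at hu
  · rintro u hu (rfl | hu') huM
    · simp at huM
    · obtain rfl : u = M := huM
      exact hd hu'

/-- Fixing conditions on the Markov blanket, the Verma constraint on `{A, Z}`. They differ only if
no edge joins `Z` and `M`, and then `M ⊥ Z | A` lets `Z` be added. -/
theorem InPattern.fixKernel_M_ae_eq (hp : IsPosDensity μ p) (hG : InPattern G)
    (h : NestedMarkov μ p G) : fixKernel μ G [M] p =ᵐ[Measure.pi μ]
      fun x => p x / kernelCond μ Finset.univ p M {A, Z} x := by
  have hfix : fixKernel μ G [M] p =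
      fun x => p x / kernelCond μ Finset.univ p M (G.mb M) x := by
    rw [← show G.rand = Finset.univ from hG.isADMG]
    rfl
  rw [hfix]
  by_cases hZM : G.dir Z M ∨ G.bi Z M
  · rw [hG.mb_M hZM]
  · rw [not_or] at hZM
    rw [hG.mb_M_of_not hZM.1 hZM.2, Finset.pair_comm]
    filter_upwards [KernelIndep.kernelCond_ae_eq hp.measurable (hp.pos.mono fun _ h => h.ne')
      hp.lmarginal_univ_ne_top (hG.densityIndep_M_Z hp h hZM.1 hZM.2)] with x hx
    rw [hx]

/-- After `M` is fixed `A` has no children, so its marginalization is the fixing of `A`. In the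
graph left on `Z` and `Y`, the vertex `Z` has no children and no bidirected edge, so `{Z}` separates
the districts. -/
theorem InPattern.vermaConstraint (hp : IsPosDensity μ p) (hG : InPattern G)
    (h : NestedMarkov μ p G) : VermaConstraint μ p := by
  have hO := hG.ordered
  have hA : ∀ u, ¬ (G.fixSeq [M]).dir A u := fun u hu => by
    have : u = M := by simpa using hG.dir_only _ _ hu.1
    exact hu.2 (by simp [this])
  have hvalid : G.ValidFixing [M, A] := ⟨hG.fixable_M,
    CADMG.fixable_of_childless (Finset.mem_sdiff.2 ⟨hO.mem_rand A, by simp⟩) hA, trivial⟩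
  have hmarg : kernelMargin μ {Z, A, Y} (fixKernel μ G [M] p) (insert Z (insert Y ∅)) =
      lmarginal μ {A} (fixKernel μ G [M] p) := rfl
  refine KernelIndep.congr (hG.fixKernel_M_ae_eq hp h) ?_
  refine h.kernelIndep hO.isADMG (hp.fixKernel_regular hO.isADMG (l := [M]) ⟨hG.fixable_M, trivial⟩).1 hvalid
    (by simp) (by simp) (by simp) (by simp) (by simp)
    (hmarg ▸ h.lmarginal_fixKernel hp hO.isADMG (l := [M]) hvalid hA) {Z} ?_ ?_ ?_
  · rintro u w hbi rfl
    have hwM : w ≠ M := by simpa using hbi.1.2.2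
    have hwA : w ≠ A := by simpa using hbi.2.2
    rcases hG.bi_only _ _ hbi.1.1 with h' | h' | h' <;> simp at h'
    · exact absurd h' hwA
    · exact absurd h' hwM
  · rintro u hu (rfl | hu')
    · rfl
    · simp only [CADMG.fixSeq, CADMG.fixSet, Finset.mem_sdiff, Finset.mem_singleton] at hu
      rcases hG.dir_only _ _ hu' with h' | h' | h' | h' <;> simp at h'
      · exact absurd h' hu.2
      · exact absurd h' hu.1.2
  · rintro u hu (rfl | hu') huZ
    · simp at huZ
    · exact hO.not_dir_Y u hu'

end FrontDoor

theorem theorem1 {X : Var → Type*} [∀ v, MeasurableSpace (X v)] (μ : ∀ v, Measure (X v))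
    [∀ v, SigmaFinite (μ v)] :
    (∀ (p : (∀ v, X v) → ℝ≥0∞) (G : CADMG Var),
      IsPosDensity μ p → G.IsADMG → NestedMarkov μ p G →
      FrontDoor.Mediates G →
      FrontDoor.NotConsequence G → ¬ DensityIndep μ p Var.Z Var.A ∅ →
      ¬ DensityIndep μ p Var.Z Var.Y {Var.A, Var.M} →
      VermaFaithful μ p G →
      FrontDoor.VermaConstraint μ p →
      (NestedMarkov μ p G ∧ FrontDoor.NoBidirectedPathToChild G) ∧
      ¬ G.dir Var.A Var.Y ∧
      (¬ G.bi Var.A Var.M ∧ ¬ G.bi Var.M Var.Y) ∧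
      FrontDoor.InPattern G) ∧
    (∀ G : CADMG Var, FrontDoor.Admissible G ↔ FrontDoor.InPattern G) ∧
    (∀ (p : (∀ v, X v) → ℝ≥0∞) (G : CADMG Var),
      IsPosDensity μ p → FrontDoor.InPattern G → NestedMarkov μ p G →
      FrontDoor.VermaConstraint μ p) := by
  refine ⟨fun p G hp hG h hM hZ hZA hZY hfaith hverma => ?_,
    fun G => ⟨fun hG => hG.inPattern, fun hG => hG.admissible⟩,
    fun p G hp hG h => hG.vermaConstraint hp h⟩
  have hpat := FrontDoor.inPattern_of_vermaConstraint hp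
    (FrontDoor.ordered_of_mediates hG hM hZ) h hZA hZY hfaith hverma
  refine ⟨⟨h, hpat.noBidirectedPathToChild⟩, fun hAY => ?_, ⟨fun hAM => ?_, fun hMY => ?_⟩, hpat⟩
  · simpa using hpat.dir_only _ _ hAY
  · exact hpat.no_path (.single hAM)
  · simpa using hpat.eq_Z_of_bi_M hMY
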